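/- **Setting.** Let $s,n_1,\dots,n_s,m\in\mathbb N$, $n=n_1+\dots+n_s$, and let $E=\mathrm{diag}(E_1,\dots,E_s)$, $R=\mathrm{diag}(R_1,\dots,R_s)$, $Q=\mathrm{diag}(Q_1,\dots,Q_s)$, $J_d=\mathrm{diag}(J_1,\dots,J_s)$ with $E_i,R_i,Q_i,J_i\in\mathbb R^{n_i\times n_i}$, $R_i=R_i^\top\ge 0$, $J_i^\top=-J_i$, $E_i^\top Q_i=Q_i^\top E_i\ge 0$ and $Q_i$ invertible. Let $J_o\in\mathbb R^{n\times n}$ be the block matrix with zero diagonal blocks, with blocks $J_{ij}\in\mathbb R^{n_i\times n_j}$ at the positions $(i,j)$, $i<j$, and with blocks $-J_{ij}^\top$ at the positions $(j,i)$. Put $J=J_d+J_o$, and let $B\in\mathbb R^{n\times m}$. Assume $\mathrm{rk}[E\ R\ J]=n$. Let $T>0$, $x_0\in\mathbb R^n$ and $u\in L^2([0,T];\mathbb R^m)$, and assume that, for matrices $Z\in\mathbb R^{n\times r}$, $Z_1\in\mathbb R^{r\times r_1}$ of full column rank with $\mathrm{im}\,Z=\ker E$ and $\mathrm{im}\,Z_1=\ker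 RQZ\cap\ker Z^\top Q^\top JQZ$, $$Z_1^\top Z^\top Q^\top Bu\in H^1([0,T];\mathbb R^{r_1}),\qquad Z_1^\top Z^\top Q^\top JQx_0+(Z_1^\top Z^\top Q^\top Bu)(0)=0 .$$ Consider the port-Hamiltonian differential-algebraic equation $$\tfrac{d}{dt}Ex=(J-R)Qx+Bu,\qquad Ex(0)=Ex_0. \tag{1}$$ A solution of (1) is an $x\in L^2([0,T];\mathbb R^n)$ with $Ex\in H^1([0,T];\mathbb R^n)$ that satisfies the initial condition and, almost everywhere on $[0,T]$, the equation. Point values of $H^1$ functions are those of the continuous representative. Let $\alpha\in[0,1]$ and $\mu\ge0$. On $L^2([0,T];\mathbb R^n)$ let $$Mx=\tfrac{d}{dt}(Ex)-(J_d-\alpha R+\mu EQ^{-1})Qx-Bu,\qquad D(M)=\{x\in L^2: Ex\in H^1,\ Ex(0)=Ex_0\},$$ $$Nx=\big((1-\alpha)R+\mu EQ^{-1}-J_o\big)Qx .$$ For $\omega\ge0$ put $\|f\|_{2,\omega}^2=\int_0^Te^{-2t\omega}\|f(t)\|^2\,dt$, where $\|\cdot\|$ is the Euclidean norm (for matrices,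 the spectral norm). **Theorem.** Let $\lambda>0$. Then (1) has a unique solution $x$, and the operators $I+\lambda NQ^{-1}:L^2\to L^2$ and $I+\lambda MQ^{-1}:Q\,D(M)\to L^2$ are bijective. Consequently, for every $x^0\in D(M)$, the iteration $$x^{k+1}=Q^{-1}(I+\lambda MQ^{-1})^{-1}(I-\lambda NQ^{-1})(I+\lambda NQ^{-1})^{-1}(I-\lambda MQ^{-1})Qx^k$$ is well defined and stays in $D(M)$. Moreover: (a) $Ex^k\to Ex$ in $L^2([0,T];\mathbb R^n)$. (b) $Ex^k(t)\to Ex(t)$ for every $t\in(0,T]$. (c) If $\alpha>0$, then $RQx^k\to RQx$ in $L^2([0,T];\mathbb R^n)$. (d) Let $z^k=(I+\lambda MQ^{-1})Qx^k$ and $z=(I+\lambda MQ^{-1})Qx$. For every $\omega\ge\mu$, the real sequence $(\|z^k-z\|_{2,\omega})_k$ is monotonically decreasing (not necessarily strictly), and $$\|x^k-x\|_{2,\omega}\le\|Q^{-1}\|\,\|z^k-z\|_{2,\omega}\qquad\text{for all }k .$$ -/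

import Mathlib

open MeasureTheory Set Filter Topology

noncomputable section

/-! ### The spaces `L²([0,T], ℝ^κ)` and `H¹([0,T], ℝ^κ)` -/

/-- Lebesgue measure on `[0, T]`. -/
abbrev timeMeasure (T : ℝ) : Measure ℝ := volume.restrict (Icc 0 T)

/-- The Hilbert space `L²([0,T], ℝ^κ)`, where `ℝ^κ` carries the Euclidean norm. Its elements are
classes of functions up to almost everywhere equality. As a set, it also is `L²_ω([0,T], ℝ^κ)`. -/
abbrev L2 (T : ℝ) (κ : Type) [Fintype κ] : Type :=
  Lp (EuclideanSpace ℝ κ) 2 (timeMeasure T)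

/-- The weighted norm `‖f‖_{2,ω} = (∫₀ᵀ e^{-2tω} ‖f(t)‖² dt)^{1/2}`. -/
def wnorm {T : ℝ} {κ : Type} [Fintype κ] (ω : ℝ) (f : L2 T κ) : ℝ :=
  Real.sqrt (∫ t in Icc 0 T, Real.exp (-2 * t * ω) * ‖f t‖ ^ 2)

/-- `d` is the weak derivative of `y` on `(0, T)`. -/
def HasWeakDeriv {T : ℝ} {κ : Type} [Fintype κ] (y d : L2 T κ) : Prop :=
  ∀ φ : ℝ → ℝ, ContDiff ℝ ((⊤ : ℕ∞) : WithTop ℕ∞) φ → HasCompactSupport φ →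
    tsupport φ ⊆ Ioo 0 T →
      ∫ t in Icc 0 T, deriv φ t • y t = - ∫ t in Icc 0 T, φ t • d t

/-- Membership in `H¹([0,T], ℝ^κ)`. -/
def MemH1 {T : ℝ} {κ : Type} [Fintype κ] (y : L2 T κ) : Prop :=
  ∃ d : L2 T κ, HasWeakDeriv y d

open Classical in
/-- The weak derivative of an element of `H¹` (it is unique), and `0` outside `H¹`. -/
def weakDeriv {T : ℝ} {κ : Type} [Fintype κ] (y : L2 T κ) : L2 T κ :=
  if h : MemH1 y then h.choose else 0

/-- `Y` is, on `[0,T]`, the continuous representative of `y`. Point values of elements of `H¹`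
are those of the continuous representative. -/
def IsContRep {T : ℝ} {κ : Type} [Fintype κ] (y : L2 T κ) (Y : ℝ → EuclideanSpace ℝ κ) : Prop :=
  ContinuousOn Y (Icc 0 T) ∧ y =ᵐ[timeMeasure T] Y

/-- A real matrix as a continuous linear map between Euclidean spaces. -/
def matCLM {ι κ : Type} [Fintype ι] [Fintype κ] [DecidableEq κ] (A : Matrix ι κ ℝ) :
    EuclideanSpace ℝ κ →L[ℝ] EuclideanSpace ℝ ι :=
  LinearMap.toContinuousLinearMap (Matrix.toEuclideanLin A)

/-- Pointwise multiplication `f ↦ A f` by a constant matrix, as an operator on `L²`. -/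
def matL2 {ι κ : Type} [Fintype ι] [Fintype κ] [DecidableEq κ] (T : ℝ) (A : Matrix ι κ ℝ) :
    L2 T κ →L[ℝ] L2 T ι :=
  (matCLM A).compLpL 2 (timeMeasure T)

/-! ### Coupled port-Hamiltonian DAEs -/

/-- The index set of `ℝ^n`, `n = n_1 + ⋯ + n_s`. -/
abbrev Idx {s : ℕ} (nn : Fin s → ℕ) : Type := Σ i : Fin s, Fin (nn i)

/-- The blocks of the coefficient matrices. -/
structure PHBlocks (s : ℕ) (nn : Fin s → ℕ) (m : ℕ) where
  Eb : ∀ i, Matrix (Fin (nn i)) (Fin (nn i)) ℝ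
  Rb : ∀ i, Matrix (Fin (nn i)) (Fin (nn i)) ℝ
  Qb : ∀ i, Matrix (Fin (nn i)) (Fin (nn i)) ℝ
  Jb : ∀ i, Matrix (Fin (nn i)) (Fin (nn i)) ℝ
  Jc : ∀ i j, i < j → Matrix (Fin (nn i)) (Fin (nn j)) ℝ
  Bb : ∀ i, Matrix (Fin (nn i)) (Fin m) ℝ

namespace PHBlocks

variable {s m : ℕ} {nn : Fin s → ℕ} (P : PHBlocks s nn m)

/-- `E = diag(E_1, …, E_s)`. -/
def E : Matrix (Idx nn) (Idx nn) ℝ := Matrix.blockDiagonal' P.Eb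

/-- `R = diag(R_1, …, R_s)`. -/
def R : Matrix (Idx nn) (Idx nn) ℝ := Matrix.blockDiagonal' P.Rb

/-- `Q = diag(Q_1, …, Q_s)`. -/
def Q : Matrix (Idx nn) (Idx nn) ℝ := Matrix.blockDiagonal' P.Qb

/-- `J_d = diag(J_1, …, J_s)`, the block diagonal part of `J`. -/
def Jd : Matrix (Idx nn) (Idx nn) ℝ := Matrix.blockDiagonal' P.Jb

/-- `J_o`, the part of `J` off the block diagonal: it has the block `J_{ij}` at `(i,j)` and the
block `-J_{ij}ᵀ` at `(j,i)` for `i < j`. -/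
def Jo : Matrix (Idx nn) (Idx nn) ℝ := Matrix.of fun p q =>
  if h : p.1 < q.1 then P.Jc p.1 q.1 h p.2 q.2
  else if h : q.1 < p.1 then - P.Jc q.1 p.1 h q.2 p.2
  else 0

/-- `J = J_d + J_o`. -/
def J : Matrix (Idx nn) (Idx nn) ℝ := P.Jd + P.Jo

/-- `B`, with the blocks `B_1, …, B_s` stacked on top of each other. -/
def B : Matrix (Idx nn) (Fin m) ℝ := Matrix.of fun p j => P.Bb p.1 p.2 j

/-- The standing assumptions on an overall coupled port-Hamiltonian DAE
`d/dt E x = (J - R) Q x + B u`, `E x(0) = E x₀` on `[0,T]`. -/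
structure Assumption (T : ℝ) (x₀ : EuclideanSpace ℝ (Idx nn)) (u : L2 T (Fin m)) : Prop where
  R_psd : ∀ i, (P.Rb i).PosSemidef
  J_skew : ∀ i, (P.Jb i).transpose = - P.Jb i
  EQ_symm : ∀ i, (P.Eb i).transpose * P.Qb i = (P.Qb i).transpose * P.Eb i
  EQ_psd : ∀ i, ((P.Eb i).transpose * P.Qb i).PosSemidef
  Q_inv : ∀ i, IsUnit (P.Qb i)
  rank_ERJ : (Matrix.fromCols P.E (Matrix.fromCols P.R P.J)).rank = ∑ i, nn i
  T_pos : 0 < T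
  consistent : ∃ (r r₁ : ℕ) (Z : Matrix (Idx nn) (Fin r) ℝ) (Z₁ : Matrix (Fin r) (Fin r₁) ℝ),
    Z.rank = r ∧ Z₁.rank = r₁ ∧
    LinearMap.range Z.mulVecLin = LinearMap.ker P.E.mulVecLin ∧
    LinearMap.range Z₁.mulVecLin =
      LinearMap.ker (P.R * P.Q * Z).mulVecLin ⊓
        LinearMap.ker (Z.transpose * P.Q.transpose * P.J * P.Q * Z).mulVecLin ∧
    MemH1 (matL2 T (Z₁.transpose * Z.transpose * P.Q.transpose * P.B) u) ∧
    ∃ Y, IsContRep (matL2 T (Z₁.transpose * Z.transpose * P.Q.transpose * P.B) u) Y ∧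
      matCLM (Z₁.transpose * Z.transpose * P.Q.transpose * P.J * P.Q) x₀ + Y 0 = 0

/-- `E x ∈ H¹` and `E x(0) = E x₀`. These are the elements of the domain of `M`. -/
def domM {T : ℝ} (x₀ : EuclideanSpace ℝ (Idx nn)) : Set (L2 T (Idx nn)) :=
  {x | MemH1 (matL2 T P.E x) ∧ ∃ Y, IsContRep (matL2 T P.E x) Y ∧ Y 0 = matCLM P.E x₀}

/-- `x` is a (weak) solution of `d/dt E x = (J - R) Q x + B u`, `E x(0) = E x₀`: one has
`E x ∈ H¹`, the initial condition, and the equation almost everywhere. -/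
def IsSolution {T : ℝ} (x₀ : EuclideanSpace ℝ (Idx nn)) (u : L2 T (Fin m))
    (x : L2 T (Idx nn)) : Prop :=
  x ∈ P.domM x₀ ∧
    weakDeriv (matL2 T P.E x) = matL2 T ((P.J - P.R) * P.Q) x + matL2 T P.B u

/-- The affine operator `M x = d/dt (E x) - (J_d - α R + μ E Q⁻¹) Q x - B u`, to be
used on its domain `domM`. -/
def opM {T : ℝ} (u : L2 T (Fin m)) (α μ : ℝ) (x : L2 T (Idx nn)) : L2 T (Idx nn) :=
  weakDeriv (matL2 T P.E x)
    - matL2 T ((P.Jd - α • P.R + μ • (P.E * P.Q⁻¹)) * P.Q) x - matL2 T P.B u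

/-- The operator `N x = ((1 - α) R + μ E Q⁻¹ - J_o) Q x`. -/
def opN {T : ℝ} (α μ : ℝ) (x : L2 T (Idx nn)) : L2 T (Idx nn) :=
  matL2 T (((1 - α) • P.R + μ • (P.E * P.Q⁻¹) - P.Jo) * P.Q) x

/-- `(I + c M Q⁻¹) v`, for a real number `c` of any sign. -/
def shiftM {T : ℝ} (u : L2 T (Fin m)) (α μ c : ℝ) (v : L2 T (Idx nn)) : L2 T (Idx nn) :=
  v + c • P.opM u α μ (matL2 T P.Q⁻¹ v)

/-- `(I + c N Q⁻¹) v`, for a real number `c` of any sign. -/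
def shiftN {T : ℝ} (α μ c : ℝ) (v : L2 T (Idx nn)) : L2 T (Idx nn) :=
  v + c • P.opN α μ (matL2 T P.Q⁻¹ v)

/-- The domain `Q D(M)` of `M Q⁻¹`. -/
def domMQ {T : ℝ} (x₀ : EuclideanSpace ℝ (Idx nn)) : Set (L2 T (Idx nn)) :=
  matL2 T P.Q '' P.domM x₀

/-- One step of the Lions–Mercier iteration,
`x ↦ Q⁻¹ (I + λ M Q⁻¹)⁻¹ (I - λ N Q⁻¹) (I + λ N Q⁻¹)⁻¹ (I - λ M Q⁻¹) Q x`. -/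
def lionsMercierStep {T : ℝ} (x₀ : EuclideanSpace ℝ (Idx nn)) (u : L2 T (Fin m))
    (α μ lam : ℝ) (x : L2 T (Idx nn)) : L2 T (Idx nn) :=
  matL2 T P.Q⁻¹
    (Function.invFunOn (P.shiftM u α μ lam) (P.domMQ x₀)
      (P.shiftN α μ (-lam)
        (Function.invFun (P.shiftN α μ lam)
          (P.shiftM u α μ (-lam) (matL2 T P.Q x)))))

end PHBlocks

end

/-! Put `v = Q x` and `S = E Q⁻¹`. The matrix `S` is congruent to `EᵀQ`, hence symmetric and
positive semidefinite. The engine is the energy balance `exists_energy`: if `d/dt S a = d` and `S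
a(0) = 0`, then the integral of `e^{-2sω}⟨d, a⟩` over `[0,t]` is half the weighted energy at time
`t` plus `ω` times the weighted integral of `⟨S a, a⟩`. Only `S a` has point values, so the energy
at time `t` is written `⟨Y, P Y⟩` with `Y = S a` and a symmetric generalized inverse `P` of `S`.

For the difference `a` of two elements of `Q D(M)` and the difference `b` of their images under `M
Q⁻¹`, the weighted integral of `⟨a, b⟩` is a sum of an end-point energy, `ω - μ` times the integral
of `⟨S a, a⟩` and `α` times that of `⟨R a, a⟩` (`exists_energy_opM`). So `M Q⁻¹` is monotone for `ω
≥ μ`, while `N Q⁻¹` is monotone pointwise in time because `J_o` is skew. Since `M x = -N x` at a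
solution, one step of the iteration lowers the squared distance of `z^k` to `z` by at least `4λ`
times the integral of `⟨a, b⟩` (`wint_lionsMercierStep`). This gives monotonicity in (d), and it
forces these integrals to zero, hence also each of their nonnegative parts: the `S` term with `ω >
μ` yields (a), the end-point energy on `[0,t]` yields (b), the `R` term yields (c).

Solvability is reduced by a Drazin inverse to a linear ODE and an algebraic part. For the resolvent
of `M Q⁻¹` the pencil has index at most one and no constraint on the data arises
(`exists_dae_solution_of_pos`). For (1) the index is at most two, and the hidden constraint involves
only the components of `B u` that are assumed differentiable and consistent
(`exists_port_hamiltonian_solution`, `mem_range_hidden`). Uniqueness follows from the energy balance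
and the rank condition. -/

/-! ### Primitives of integrable functions -/

section Primitive

variable {W W' : Type*} [NormedAddCommGroup W] [NormedSpace ℝ W]
  [NormedAddCommGroup W'] [NormedSpace ℝ W'] {T : ℝ}

/-- Almost everywhere on `[0, T]`, `y` is the primitive of `d` with initial value `c`. -/
def IsPrim (T : ℝ) (c : W) (d y : ℝ → W) : Prop :=
  ∀ᵐ t ∂timeMeasure T, y t = c + ∫ s in (0 : ℝ)..t, d s

lemma intervalIntegrable_of_timeMeasure {U : Type*} [NormedAddCommGroup U] {d : ℝ → U}
    (hd : Integrable d (timeMeasure T)) {t : ℝ} (ht : t ∈ Icc 0 T) :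
    IntervalIntegrable d volume 0 t := by
  rw [intervalIntegrable_iff_integrableOn_Icc_of_le ht.1]
  exact IntegrableOn.mono_set hd (Icc_subset_Icc_right ht.2)

lemma continuousOn_prim {d : ℝ → W} (hd : Integrable d (timeMeasure T)) (hT : 0 ≤ T) (c : W) :
    ContinuousOn (fun t => c + ∫ s in (0 : ℝ)..t, d s) (Icc 0 T) := by
  refine continuousOn_const.add ?_
  have := intervalIntegral.continuousOn_primitive_interval (μ := volume) (f := d) (a := 0) (b := T)
    (by rw [uIcc_of_le hT]; exact hd)
  rwa [uIcc_of_le hT] at this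

lemma intervalIntegral_indicator_Icc (d : ℝ → W) {t : ℝ} (ht : t ∈ Icc 0 T) :
    ∫ s in (0 : ℝ)..t, (Icc 0 T).indicator d s = ∫ s in (0 : ℝ)..t, d s := by
  refine intervalIntegral.integral_congr fun s hs => ?_
  rw [uIcc_of_le ht.1] at hs
  exact indicator_of_mem (Icc_subset_Icc_right ht.2 hs) _

lemma integral_congr_of_timeMeasure {d d' : ℝ → W} (h : d =ᵐ[timeMeasure T] d') {t : ℝ}
    (ht : t ∈ Icc 0 T) : ∫ s in (0 : ℝ)..t, d s = ∫ s in (0 : ℝ)..t, d' s := by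
  refine intervalIntegral.integral_congr_ae ?_
  rw [EventuallyEq, ae_restrict_iff' measurableSet_Icc] at h
  filter_upwards [h] with s hs hst
  rw [uIoc_of_le ht.1] at hst
  exact hs ⟨hst.1.le, hst.2.trans ht.2⟩

lemma ae_timeMeasure_mem : ∀ᵐ t ∂timeMeasure T, t ∈ Icc 0 T := ae_restrict_mem measurableSet_Icc

lemma IsPrim.congr {c : W} {d d' y y' : ℝ → W} (h : IsPrim T c d y)
    (hd : d =ᵐ[timeMeasure T] d') (hy : y =ᵐ[timeMeasure T] y') : IsPrim T c d' y' := by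
  filter_upwards [h, hy, ae_timeMeasure_mem] with t h1 h2 h3
  rw [← h2, h1, integral_congr_of_timeMeasure hd h3]

lemma IsPrim.map [CompleteSpace W] [CompleteSpace W'] {c : W} {d y : ℝ → W} (h : IsPrim T c d y)
    (hd : Integrable d (timeMeasure T)) (L : W →L[ℝ] W') :
    IsPrim T (L c) (fun t => L (d t)) (fun t => L (y t)) := by
  filter_upwards [h, ae_timeMeasure_mem] with t h1 h3
  rw [h1, map_add, L.intervalIntegral_comp_comm (intervalIntegrable_of_timeMeasure hd h3)]

lemma IsPrim.add {c c' : W} {d d' y y' : ℝ → W} (h : IsPrim T c d y) (h' : IsPrim T c' d' y')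
    (hd : Integrable d (timeMeasure T)) (hd' : Integrable d' (timeMeasure T)) :
    IsPrim T (c + c') (fun t => d t + d' t) (fun t => y t + y' t) := by
  filter_upwards [h, h', ae_timeMeasure_mem] with t h1 h2 h3
  rw [h1, h2, intervalIntegral.integral_add (intervalIntegrable_of_timeMeasure hd h3)
    (intervalIntegrable_of_timeMeasure hd' h3)]
  abel

lemma IsPrim.sub {c c' : W} {d d' y y' : ℝ → W} (h : IsPrim T c d y) (h' : IsPrim T c' d' y')
    (hd : Integrable d (timeMeasure T)) (hd' : Integrable d' (timeMeasure T)) :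
    IsPrim T (c - c') (fun t => d t - d' t) (fun t => y t - y' t) := by
  filter_upwards [h, h', ae_timeMeasure_mem] with t h1 h2 h3
  rw [h1, h2, intervalIntegral.integral_sub (intervalIntegrable_of_timeMeasure hd h3)
    (intervalIntegrable_of_timeMeasure hd' h3)]
  abel

lemma eqOn_of_ae_timeMeasure {U : Type*} [NormedAddCommGroup U] {f g : ℝ → U}
    (hT : 0 < T) (h : f =ᵐ[timeMeasure T] g) (hf : ContinuousOn f (Icc 0 T))
    (hg : ContinuousOn g (Icc 0 T)) : EqOn f g (Icc 0 T) :=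
  Measure.eqOn_Icc_of_ae_eq volume hT.ne h hf hg

lemma ae_timeMeasure_of_Ioo {p : ℝ → Prop} (h : ∀ᵐ t, t ∈ Ioo 0 T → p t) :
    ∀ᵐ t ∂timeMeasure T, p t := by
  rw [timeMeasure,
    ← Measure.restrict_congr_set (Ioo_ae_eq_Icc (μ := volume) (a := (0 : ℝ)) (b := T))]
  rwa [ae_restrict_iff' measurableSet_Ioo]

/-- The initial value and the derivative of a primitive are unique. -/
lemma IsPrim.unique [CompleteSpace W] {c c' : W} {d d' y : ℝ → W} (hT : 0 < T)
    (h : IsPrim T c d y) (h' : IsPrim T c' d' y)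
    (hd : Integrable d (timeMeasure T)) (hd' : Integrable d' (timeMeasure T)) :
    c = c' ∧ d =ᵐ[timeMeasure T] d' := by
  have hEq : EqOn (fun t => c + ∫ s in (0 : ℝ)..t, d s) (fun t => c' + ∫ s in (0 : ℝ)..t, d' s)
      (Icc 0 T) := by
    refine eqOn_of_ae_timeMeasure hT ?_ (continuousOn_prim hd hT.le c)
      (continuousOn_prim hd' hT.le c')
    filter_upwards [h, h'] with t h1 h2
    rw [← h1, ← h2]
  have hc : c = c' := by simpa using hEq ⟨le_rfl, hT.le⟩
  refine ⟨hc, ?_⟩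
  have hTm : T ∈ Icc 0 T := ⟨hT.le, le_rfl⟩
  refine ae_timeMeasure_of_Ioo ?_
  -- By Lebesgue differentiation, at almost every interior point both primitives have their
  -- integrands as derivatives, and the primitives coincide nearby.
  filter_upwards [(intervalIntegrable_of_timeMeasure hd hTm).ae_hasDerivAt_integral,
    (intervalIntegrable_of_timeMeasure hd' hTm).ae_hasDerivAt_integral] with t h1 h2 ht
  rw [uIcc_of_le hT.le] at h1 h2
  have h1 := h1 ⟨ht.1.le, ht.2.le⟩ 0 ⟨le_rfl, hT.le⟩
  have h2 := h2 ⟨ht.1.le, ht.2.le⟩ 0 ⟨le_rfl, hT.le⟩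
  refine h1.unique (h2.congr_of_eventuallyEq ?_)
  filter_upwards [Ioo_mem_nhds ht.1 ht.2] with s hs
  simpa [hc] using hEq ⟨hs.1.le, hs.2.le⟩

lemma AbsolutelyContinuousOnInterval.integral_eq_sub_of_ae_hasDerivAt {f f' : ℝ → ℝ} {a b : ℝ}
    (hf : AbsolutelyContinuousOnInterval f a b)
    (h : ∀ᵐ x, x ∈ uIcc a b → HasDerivAt f (f' x) x) :
    ∫ x in a..b, f' x = f b - f a := by
  rw [← hf.integral_deriv_eq_sub]
  refine intervalIntegral.integral_congr_ae ?_
  filter_upwards [h] with x hx hx'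
  exact (hx (uIoc_subset_uIcc hx')).deriv.symm

/-- Absolute continuity is used for scalar functions only; vector-valued primitives enter through
functionals. -/
lemma absolutelyContinuous_clm_prim [CompleteSpace W] {d : ℝ → W} (hd : Integrable d)
    (L : W →L[ℝ] ℝ) {t : ℝ} :
    AbsolutelyContinuousOnInterval (fun s => L (∫ r in (0 : ℝ)..s, d r)) 0 t := by
  have h : (fun s => L (∫ r in (0 : ℝ)..s, d r)) = fun s => ∫ r in (0 : ℝ)..s, L (d r) := by
    funext s
    rw [L.intervalIntegral_comp_comm hd.intervalIntegrable]
  rw [h]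
  exact (L.integrable_comp hd).intervalIntegrable.absolutelyContinuousOnInterval_intervalIntegral
    left_mem_uIcc

lemma absolutelyContinuousOnInterval_sum {ι : Type*} (s : Finset ι) {f : ι → ℝ → ℝ} {a b : ℝ}
    (h : ∀ i ∈ s, AbsolutelyContinuousOnInterval (f i) a b) :
    AbsolutelyContinuousOnInterval (fun t => ∑ i ∈ s, f i t) a b := by
  classical
  induction s using Finset.induction_on with
  | empty =>
    simp only [Finset.sum_empty]
    exact (contDiff_const (n := 1)).contDiffOn.absolutelyContinuousOnInterval
  | insert i s hi ih =>
    simp only [Finset.sum_insert hi]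
    exact (h i (Finset.mem_insert_self i s)).add
      (ih fun j hj => h j (Finset.mem_insert_of_mem hj))

end Primitive

/-! ### The energy identity for primitives -/

section Energy

open scoped RealInnerProductSpace

variable {W : Type*} [NormedAddCommGroup W] [InnerProductSpace ℝ W] [FiniteDimensional ℝ W] {T : ℝ}

/-- The left side is absolutely continuous in `t` and vanishes at `0`; the integrand on the right is
its derivative almost everywhere, the symmetry of `P` merging the two terms of the product rule. -/
lemma exp_mul_inner_prim_of_integrable {d : ℝ → W} (hd : Integrable d) (P : W →L[ℝ] W)
    (hP : ∀ x y, ⟪P x, y⟫ = ⟪x, P y⟫) (ω t : ℝ) :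
    Real.exp (-2 * t * ω) * ⟪∫ r in (0 : ℝ)..t, d r, P (∫ r in (0 : ℝ)..t, d r)⟫ =
      ∫ s in (0 : ℝ)..t, Real.exp (-2 * s * ω) * (2 * ⟪d s, P (∫ r in (0 : ℝ)..s, d r)⟫
        - 2 * ω * ⟪∫ r in (0 : ℝ)..s, d r, P (∫ r in (0 : ℝ)..s, d r)⟫) := by
  have : CompleteSpace W := FiniteDimensional.complete ℝ W
  set Y : ℝ → W := fun t => ∫ r in (0 : ℝ)..t, d r with hY
  have hAC : AbsolutelyContinuousOnInterval
      (fun s => Real.exp (-2 * s * ω) * ⟪Y s, P (Y s)⟫) 0 t := by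
    refine AbsolutelyContinuousOnInterval.fun_mul ?_ ?_
    · exact ContDiffOn.absolutelyContinuousOnInterval (by fun_prop)
    -- In an orthonormal basis the quadratic form is a finite sum of products of scalar primitives.
    · set b := stdOrthonormalBasis ℝ W
      have : (fun s => ⟪Y s, P (Y s)⟫) =
          fun s => ∑ i, (innerSL ℝ (b i) (Y s)) * ((innerSL ℝ (b i)).comp P) (Y s) := by
        funext s
        rw [← b.sum_inner_mul_inner]
        refine Finset.sum_congr rfl fun i _ => ?_
        simp [real_inner_comm]
      rw [this]
      refine absolutelyContinuousOnInterval_sum _ fun i _ => ?_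
      exact (absolutelyContinuous_clm_prim hd _).fun_mul (absolutelyContinuous_clm_prim hd _)
  have h := hAC.integral_eq_sub_of_ae_hasDerivAt
    (f' := fun s => Real.exp (-2 * s * ω) * (2 * ⟪d s, P (Y s)⟫ - 2 * ω * ⟪Y s, P (Y s)⟫)) ?_
  · rw [h]; simp [hY]
  · filter_upwards [LocallyIntegrable.ae_hasDerivAt_integral hd.locallyIntegrable] with s hs _
    have h1 : HasDerivAt Y (d s) s := hs 0
    have h2 := h1.inner ℝ (P.hasFDerivAt.comp_hasDerivAt s h1)
    have h3 : HasDerivAt (fun s => Real.exp (-2 * s * ω)) (Real.exp (-2 * s * ω) * (-2 * ω)) s := by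
      have : HasDerivAt (fun s : ℝ => -2 * s * ω) (-2 * ω) s := by
        simpa using ((hasDerivAt_id s).const_mul (-2)).mul_const ω
      exact this.exp
    refine (h3.mul h2).congr_deriv ?_
    simp only [Function.comp_apply]
    rw [← hP (Y s) (d s), real_inner_comm (d s) (P (Y s))]
    ring

/-- The energy identity for the primitive of `d` and a symmetric operator `P`. -/
lemma exp_mul_inner_prim {d : ℝ → W} (hd : Integrable d (timeMeasure T)) (P : W →L[ℝ] W)
    (hP : ∀ x y, ⟪P x, y⟫ = ⟪x, P y⟫) (ω : ℝ) {t : ℝ} (ht : t ∈ Icc 0 T) :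
    Real.exp (-2 * t * ω) * ⟪∫ r in (0 : ℝ)..t, d r, P (∫ r in (0 : ℝ)..t, d r)⟫ =
      ∫ s in (0 : ℝ)..t, Real.exp (-2 * s * ω) * (2 * ⟪d s, P (∫ r in (0 : ℝ)..s, d r)⟫
        - 2 * ω * ⟪∫ r in (0 : ℝ)..s, d r, P (∫ r in (0 : ℝ)..s, d r)⟫) := by
  -- Extension of `d` by zero outside `[0,T]` does not alter the primitive on `[0,t]`.
  have h := exp_mul_inner_prim_of_integrable
    ((integrable_indicator_iff measurableSet_Icc).2 hd) P hP ω t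
  rw [intervalIntegral_indicator_Icc d ht] at h
  rw [h]
  refine intervalIntegral.integral_congr fun s hs => ?_
  rw [uIcc_of_le ht.1] at hs
  have hs' : s ∈ Icc 0 T := Icc_subset_Icc_right ht.2 hs
  simp only [intervalIntegral_indicator_Icc d hs', indicator_of_mem hs']

end Energy

/-! ### Weak derivatives -/

section WeakDeriv

variable {T : ℝ}

/-- The primitive from `0` vanishes to the left of the support of `θ`, and to its right because `θ`
has mean zero. -/
lemma exists_smooth_prim (hT : 0 < T) {θ : ℝ → ℝ}
    (hθ : ContDiff ℝ ((⊤ : ℕ∞) : WithTop ℕ∞) θ) (hc : HasCompactSupport θ)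
    (hs : tsupport θ ⊆ Ioo 0 T) (h0 : ∫ t, θ t = 0) :
    ∃ φ : ℝ → ℝ, ContDiff ℝ ((⊤ : ℕ∞) : WithTop ℕ∞) φ ∧ HasCompactSupport φ ∧
      tsupport φ ⊆ Ioo 0 T ∧ deriv φ = θ := by
  obtain ⟨a, b, ha, hb, hab⟩ : ∃ a b, 0 < a ∧ b < T ∧ tsupport θ ⊆ Icc a b := by
    rcases (tsupport θ).eq_empty_or_nonempty with h | h
    · exact ⟨T / 2, T / 2, by linarith, by linarith, by simp [h]⟩
    · obtain ⟨a, ha⟩ := IsCompact.exists_isLeast hc h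
      obtain ⟨b, hb⟩ := IsCompact.exists_isGreatest hc h
      exact ⟨a, b, (hs ha.1).1, (hs hb.1).2, fun x hx => ⟨ha.2 hx, hb.2 hx⟩⟩
  have hz : ∀ t, t ∉ Icc a b → θ t = 0 := fun t ht =>
    image_eq_zero_of_notMem_tsupport fun h => ht (hab h)
  have hderiv : ∀ t, HasDerivAt (fun t => ∫ s in (0 : ℝ)..t, θ s) (θ t) t := fun t =>
    intervalIntegral.integral_hasDerivAt_right (hθ.continuous.intervalIntegrable _ _)
      (hθ.continuous.stronglyMeasurableAtFilter _ _) hθ.continuous.continuousAt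
  have hd : deriv (fun t => ∫ s in (0 : ℝ)..t, θ s) = θ := funext fun t => (hderiv t).deriv
  have hsupp : Function.support (fun t => ∫ s in (0 : ℝ)..t, θ s) ⊆ Icc a b := by
    intro t ht
    by_contra hcon
    refine ht ?_
    rcases lt_or_ge t a with h | h
    · have : ∫ s in (0 : ℝ)..t, θ s = ∫ s in (0 : ℝ)..t, (0 : ℝ) := by
        refine intervalIntegral.integral_congr fun s hs => hz s fun hs' => ?_
        have : s ≤ max 0 t := hs.2
        have := max_lt ha h
        linarith [hs'.1]
      simpa using this
    · have hbt : b < t := by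
        by_contra hbt
        exact hcon ⟨h, not_lt.1 hbt⟩
      have : ∫ s in (0 : ℝ)..t, θ s = ∫ s, θ s := by
        refine intervalIntegral.integral_eq_integral_of_support_subset fun s hs => ?_
        have := hab (subset_tsupport _ hs)
        exact ⟨by linarith [this.1], by linarith [this.2]⟩
      simp only
      rw [this, h0]
  have hts : tsupport (fun t => ∫ s in (0 : ℝ)..t, θ s) ⊆ Icc a b :=
    closure_minimal hsupp isClosed_Icc
  refine ⟨fun t => ∫ s in (0 : ℝ)..t, θ s, ?_, ?_, ?_, hd⟩
  · rw [contDiff_infty_iff_deriv, hd]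
    exact ⟨fun t => (hderiv t).differentiableAt, hθ⟩
  · exact isCompact_Icc.of_isClosed_subset (isClosed_tsupport _) hts
  · exact hts.trans (Icc_subset_Ioo ha hb)

lemma exists_smooth_integral_one (hT : 0 < T) :
    ∃ η : ℝ → ℝ, ContDiff ℝ ((⊤ : ℕ∞) : WithTop ℕ∞) η ∧ HasCompactSupport η ∧
      tsupport η ⊆ Ioo 0 T ∧ ∫ t, η t = 1 := by
  let β : ContDiffBump (T / 2) := ⟨T / 8, T / 4, by linarith, by linarith⟩
  refine ⟨β.normed volume, β.contDiff_normed, β.hasCompactSupport_normed, ?_, β.integral_normed⟩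
  rw [β.tsupport_normed_eq, Real.closedBall_eq_Icc]
  exact Icc_subset_Ioo (by change 0 < T / 2 - T / 4; linarith)
    (by change T / 2 + T / 4 < T; linarith)

variable {W : Type*} [NormedAddCommGroup W] [NormedSpace ℝ W] [CompleteSpace W]

lemma integrable_test_smul {U : Type*} [NormedAddCommGroup U] [NormedSpace ℝ U] {f : ℝ → U}
    (hf : Integrable f (timeMeasure T)) {φ : ℝ → ℝ}
    (hφ : Continuous φ) : Integrable (fun t => φ t • f t) (timeMeasure T) := by
  have : IntegrableOn f (Icc 0 T) := hf
  exact this.continuousOn_smul hφ.continuousOn isCompact_Icc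

lemma setIntegral_test {φ : ℝ → ℝ} (hs : tsupport φ ⊆ Ioo 0 T) :
    ∫ t in Icc 0 T, φ t = ∫ t, φ t :=
  setIntegral_eq_integral_of_forall_compl_eq_zero fun _ ht =>
    image_eq_zero_of_notMem_tsupport fun h => ht (Ioo_subset_Icc_self (hs h))

/-- The du Bois-Reymond lemma. -/
lemma exists_ae_eq_const_of_integral_deriv_smul_eq_zero (hT : 0 < T) {f : ℝ → W}
    (hf : Integrable f (timeMeasure T))
    (h : ∀ φ : ℝ → ℝ, ContDiff ℝ ((⊤ : ℕ∞) : WithTop ℕ∞) φ → HasCompactSupport φ →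
      tsupport φ ⊆ Ioo 0 T → ∫ t in Icc 0 T, deriv φ t • f t = 0) :
    ∃ c, ∀ᵐ t ∂timeMeasure T, f t = c := by
  obtain ⟨η, hη, hηc, hηs, hη1⟩ := exists_smooth_integral_one hT
  -- As `η` has integral one, a constant `f` must equal this average.
  set c := ∫ t in Icc 0 T, η t • f t with hc
  refine ⟨c, ?_⟩
  have key : ∀ᵐ t ∂timeMeasure T, t ∈ Ioo 0 T → f t - c = 0 := by
    refine isOpen_Ioo.ae_eq_zero_of_integral_contDiff_smul_eq_zero ?_ ?_
    · exact (hf.sub (integrable_const c)).locallyIntegrable.locallyIntegrableOn _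
    · intro ψ hψ hψc hψs
      -- Subtracting this multiple of `η` makes the mean zero, so that the result is the derivative
      -- of a test function.
      set θ : ℝ → ℝ := ψ - (∫ t, ψ t) • η with hθ
      have hψi : Integrable ψ := hψ.continuous.integrable_of_hasCompactSupport hψc
      have hηi : Integrable η := hη.continuous.integrable_of_hasCompactSupport hηc
      have hsub : tsupport θ ⊆ tsupport ψ ∪ tsupport η := by
        refine closure_minimal ?_ ((isClosed_tsupport _).union (isClosed_tsupport _))
        intro t ht
        by_contra hcon
        rw [mem_union, not_or] at hcon
        refine ht ?_
        simp [hθ, image_eq_zero_of_notMem_tsupport hcon.1, image_eq_zero_of_notMem_tsupport hcon.2]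
      obtain ⟨φ, hφ, hφc, hφs, hφd⟩ := exists_smooth_prim hT (θ := θ)
        (hψ.sub (contDiff_const.smul hη))
        ((IsCompact.union hψc hηc).of_isClosed_subset (isClosed_tsupport _) hsub)
        (hsub.trans (union_subset hψs hηs)) (by
          simp only [hθ, Pi.sub_apply, Pi.smul_apply, smul_eq_mul]
          rw [integral_sub hψi (hηi.const_mul _), integral_const_mul, hη1]
          ring)
      have h0 := h φ hφ hφc hφs
      rw [hφd] at h0
      have e1 : ∫ t in Icc 0 T, θ t • f t =
          (∫ t in Icc 0 T, ψ t • f t) - (∫ t, ψ t) • c := by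
        simp only [hθ, Pi.sub_apply, Pi.smul_apply, sub_smul, smul_assoc]
        have i3 : Integrable (fun t => (∫ t, ψ t) • η t • f t) (timeMeasure T) :=
          (integrable_test_smul hf hη.continuous).smul _
        rw [integral_sub (integrable_test_smul hf hψ.continuous) i3, integral_smul]
      simp only [smul_sub]
      rw [integral_sub (integrable_test_smul hf hψ.continuous)
          (integrable_test_smul (integrable_const c) hψ.continuous), integral_smul_const,
          setIntegral_test hψs, ← e1, h0]
  refine ae_timeMeasure_of_Ioo ?_
  rw [ae_restrict_iff' measurableSet_Icc] at key
  filter_upwards [key] with t ht ht'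
  exact sub_eq_zero.1 (ht (Ioo_subset_Icc_self ht') ht')

/-- Coordinatewise, `φ` times the primitive is absolutely continuous and vanishes at `0` and `T`, so
its derivative integrates to zero. -/
lemma integral_deriv_smul_prim (hT : 0 < T) {κ : Type*} [Fintype κ] {d : ℝ → EuclideanSpace ℝ κ}
    (hd : Integrable d (timeMeasure T)) (c : EuclideanSpace ℝ κ) {φ : ℝ → ℝ}
    (hφ : ContDiff ℝ ((⊤ : ℕ∞) : WithTop ℕ∞) φ) (hs : tsupport φ ⊆ Ioo 0 T) :
    ∫ t in Icc 0 T, deriv φ t • (c + ∫ s in (0 : ℝ)..t, d s) = - ∫ t in Icc 0 T, φ t • d t := by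
  have hz : ∀ t, t ∉ Ioo 0 T → φ t = 0 := fun t ht =>
    image_eq_zero_of_notMem_tsupport fun h => ht (hs h)
  have hφ' : Continuous (deriv φ) := hφ.continuous_deriv (by simp)
  set e : ℝ → EuclideanSpace ℝ κ := (Icc 0 T).indicator d with he
  have hei : Integrable e := (integrable_indicator_iff measurableSet_Icc).2 hd
  have e1 : ∫ t in Icc 0 T, deriv φ t • (c + ∫ s in (0 : ℝ)..t, d s) =
      ∫ t in Icc 0 T, deriv φ t • (c + ∫ s in (0 : ℝ)..t, e s) :=
    setIntegral_congr_fun measurableSet_Icc fun t ht => by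
      simp only [he, intervalIntegral_indicator_Icc d ht]
  have e2 : ∫ t in Icc 0 T, φ t • d t = ∫ t in Icc 0 T, φ t • e t :=
    setIntegral_congr_fun measurableSet_Icc fun t ht => by
      simp only [he, indicator_of_mem ht]
  rw [e1, e2]
  have hcont : Continuous fun t => c + ∫ s in (0 : ℝ)..t, e s :=
    continuous_const.add (intervalIntegral.continuous_primitive
      (fun _ _ => hei.intervalIntegrable) 0)
  have i1 : Integrable (fun t => deriv φ t • (c + ∫ s in (0 : ℝ)..t, e s)) (timeMeasure T) :=
    (hφ'.smul hcont).integrableOn_Icc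
  have i2 : Integrable (fun t => φ t • e t) (timeMeasure T) :=
    integrable_test_smul hei.restrict hφ.continuous
  rw [eq_neg_iff_add_eq_zero, ← integral_add i1 i2]
  ext i
  have i3 : Integrable (fun t => deriv φ t • (c + ∫ s in (0 : ℝ)..t, e s) + φ t • e t)
      (timeMeasure T) := i1.add i2
  set L : EuclideanSpace ℝ κ →L[ℝ] ℝ := EuclideanSpace.proj i
  have hL : ∀ x, x i = L x := fun _ => rfl
  rw [hL, ← L.integral_comp_comm i3, integral_Icc_eq_integral_Ioc,
    ← intervalIntegral.integral_of_le hT.le]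
  have hAC : AbsolutelyContinuousOnInterval
      (fun t => φ t * (c i + L (∫ s in (0 : ℝ)..t, e s))) 0 T := by
    refine AbsolutelyContinuousOnInterval.fun_mul ?_ (AbsolutelyContinuousOnInterval.fun_add ?_ ?_)
    · exact (hφ.of_le (by simp) : ContDiff ℝ 1 φ).contDiffOn.absolutelyContinuousOnInterval
    · exact (contDiff_const (n := 1)).contDiffOn.absolutelyContinuousOnInterval
    · exact absolutelyContinuous_clm_prim hei L
  have := hAC.integral_eq_sub_of_ae_hasDerivAt
    (f' := fun t => L (deriv φ t • (c + ∫ s in (0 : ℝ)..t, e s) + φ t • e t)) ?_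
  · rw [this, hz 0 (by simp), hz T (by simp)]; simp
  · filter_upwards [LocallyIntegrable.ae_hasDerivAt_integral hei.locallyIntegrable] with t ht _
    have h1 := (hφ.differentiable (by simp) t).hasDerivAt
    have h2 := ((L.hasFDerivAt.comp_hasDerivAt t (ht 0)).const_add (c i))
    refine (h1.mul h2).congr_deriv ?_
    simp only [Function.comp_apply, map_add, map_smul, smul_eq_mul, hL]

variable {κ : Type} [Fintype κ]

lemma L2.integrable (f : L2 T κ) : Integrable f (timeMeasure T) :=
  (Lp.memLp f).integrable (by norm_num)

lemma hasWeakDeriv_of_isPrim (hT : 0 < T) {y d : L2 T κ} {c : EuclideanSpace ℝ κ}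
    (h : IsPrim T c d y) : HasWeakDeriv y d := by
  intro φ hφ _ hs
  rw [← integral_deriv_smul_prim hT (L2.integrable d) c hφ hs]
  refine integral_congr_ae ?_
  filter_upwards [h] with t ht
  rw [ht]

/-- The difference of `y` and a primitive of `d` has weak derivative zero, hence is constant by the
du Bois-Reymond lemma. From here on, `H¹` is handled through primitives. -/
lemma HasWeakDeriv.exists_isPrim (hT : 0 < T) {y d : L2 T κ} (h : HasWeakDeriv y d) :
    ∃ c, IsPrim T c d y := by
  have hcont := continuousOn_prim (L2.integrable d) hT.le 0
  have hint : Integrable (fun t => 0 + ∫ s in (0 : ℝ)..t, d s) (timeMeasure T) :=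
    hcont.integrableOn_Icc
  obtain ⟨c, hc⟩ := exists_ae_eq_const_of_integral_deriv_smul_eq_zero hT
    ((L2.integrable y).sub hint) (fun φ hφ hφc hφs => by
      have hφ' : Continuous (deriv φ) := hφ.continuous_deriv (by simp)
      simp only [Pi.sub_apply, smul_sub]
      rw [integral_sub (integrable_test_smul (L2.integrable y) hφ')
        (integrable_test_smul hint hφ'), h φ hφ hφc hφs,
        integral_deriv_smul_prim hT (L2.integrable d) 0 hφ hφs, sub_self])
  refine ⟨c, ?_⟩
  filter_upwards [hc] with t ht
  simp only [Pi.sub_apply, zero_add] at ht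
  exact eq_add_of_sub_eq ht

lemma weakDeriv_eq_of_isPrim (hT : 0 < T) {y d : L2 T κ} {c : EuclideanSpace ℝ κ}
    (h : IsPrim T c d y) : MemH1 y ∧ weakDeriv y = d := by
  have hm : MemH1 y := ⟨d, hasWeakDeriv_of_isPrim hT h⟩
  refine ⟨hm, ?_⟩
  rw [weakDeriv, dif_pos hm]
  obtain ⟨c', hc'⟩ := hm.choose_spec.exists_isPrim hT
  exact Lp.ext (hc'.unique hT h (L2.integrable _) (L2.integrable _)).2

lemma IsPrim.isContRep (hT : 0 < T) {y d : L2 T κ} {c : EuclideanSpace ℝ κ}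
    (h : IsPrim T c d y) : IsContRep y (fun t => c + ∫ s in (0 : ℝ)..t, d s) :=
  ⟨continuousOn_prim (L2.integrable d) hT.le c, h⟩

lemma MemH1.exists_isPrim (hT : 0 < T) {y : L2 T κ} (h : MemH1 y)
    {Y : ℝ → EuclideanSpace ℝ κ} (hY : IsContRep y Y) :
    IsPrim T (Y 0) (weakDeriv y) y := by
  obtain ⟨d, hd⟩ := h
  obtain ⟨c, hc⟩ := hd.exists_isPrim hT
  rw [(weakDeriv_eq_of_isPrim hT hc).2]
  have := eqOn_of_ae_timeMeasure hT (hY.2.symm.trans hc) hY.1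
    (continuousOn_prim (L2.integrable d) hT.le c) (x := 0) ⟨le_rfl, hT.le⟩
  simp only [intervalIntegral.integral_same, add_zero] at this
  rwa [this]

end WeakDeriv

/-! ### Drazin inverses of operators of index at most two -/

section Drazin

variable {W : Type*} [NormedAddCommGroup W] [NormedSpace ℝ W] [FiniteDimensional ℝ W]

/-- An operator of index at most two has a Drazin inverse. -/
lemma exists_drazin_inverse (C : W →L[ℝ] W) (h : ∀ x, C (C (C x)) = 0 → C (C x) = 0) :
    ∃ F : W →L[ℝ] W, (∀ x, C (F x) = F (C x)) ∧ (∀ x, F (C (F x)) = F x) ∧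
      ∀ x, C (C (F (C x))) = C (C x) := by
  classical
  obtain ⟨p, hp0, hp⟩ : ∃ p : Polynomial ℝ, p ≠ 0 ∧
      ∀ x, (Polynomial.aeval (C : W →ₗ[ℝ] W) p) x = 0 :=
    ⟨_, (LinearMap.charpoly_monic (C : W →ₗ[ℝ] W)).ne_zero, fun x => by
      rw [LinearMap.aeval_self_charpoly]; rfl⟩
  obtain ⟨q, hpq, hq⟩ := Polynomial.exists_eq_pow_rootMultiplicity_mul_and_not_dvd p hp0 0
  set k := Polynomial.rootMultiplicity 0 p
  set L : Module.End ℝ W := (C : W →ₗ[ℝ] W) with hL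
  -- The index hypothesis lowers any power in the factor `X ^ k` of the characteristic polynomial to
  -- the second one, so that `C² q(C) = 0` with `q(0) ≠ 0`.
  have hpow : ∀ k x, (L ^ k) x = 0 → C (C x) = 0 := by
    intro k
    induction k with
    | zero => intro x hx; simp only [pow_zero, Module.End.one_apply] at hx; simp [hx]
    | succ k ih =>
      intro x hx
      rw [pow_succ, Module.End.mul_apply] at hx
      exact h x (ih _ hx)
  have hq0 : q.coeff 0 ≠ 0 := by
    intro h0
    apply hq
    simpa using Polynomial.X_dvd_iff.2 h0
  have hCq : ∀ x, C (C (Polynomial.aeval L q x)) = 0 := fun x => by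
    refine hpow k _ ?_
    have := hp x
    rw [hpq] at this
    simpa using this
  set c := q.coeff 0 with hc
  -- Writing `q = X · q.divX + c` and solving `C² q(C) = 0` for `C²` gives `C² = C³ S`. The Drazin
  -- inverse is then `C² S³`.
  set S : Module.End ℝ W := Polynomial.aeval L (-(Polynomial.C c⁻¹ * q.divX)) with hS
  have hSC : Commute L S := by
    have : Commute (Polynomial.X : Polynomial ℝ) (-(Polynomial.C c⁻¹ * q.divX)) := Commute.all _ _
    simpa [hS] using this.map (Polynomial.aeval L)
  have hCS : L ^ 2 = L ^ 3 * S := by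
    have h1 : L ^ 2 * Polynomial.aeval L q = 0 := LinearMap.ext fun x => by
      simpa [pow_two, Module.End.mul_apply, hL] using hCq x
    rw [← Polynomial.X_mul_divX_add q, ← hc] at h1
    simp only [map_add, map_mul, Polynomial.aeval_X, Polynomial.aeval_C] at h1
    have h2 : L ^ 3 * Polynomial.aeval L q.divX = - (c • L ^ 2) := by
      rw [mul_add, ← mul_assoc, ← pow_succ, Algebra.algebraMap_eq_smul_one, mul_smul_comm,
        mul_one] at h1
      exact eq_neg_of_add_eq_zero_left h1
    rw [hS]
    simp only [map_neg, map_mul, Polynomial.aeval_C, Algebra.algebraMap_eq_smul_one, smul_mul_assoc,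
      one_mul, mul_neg, mul_smul_comm, h2, smul_neg, neg_neg, smul_smul, inv_mul_cancel₀ hq0,
      one_smul]
  have h5 : L ^ 5 * S ^ 3 = L ^ 2 := by
    have e4 : L ^ 4 * S ^ 2 = L ^ 2 := by
      calc L ^ 4 * S ^ 2 = L * (L ^ 3 * S) * S := by noncomm_ring
        _ = L * L ^ 2 * S := by rw [← hCS]
        _ = L ^ 3 * S := by noncomm_ring
        _ = L ^ 2 := hCS.symm
    calc L ^ 5 * S ^ 3 = L ^ 2 * (L ^ 3 * S) * S ^ 2 := by noncomm_ring
      _ = L ^ 2 * L ^ 2 * S ^ 2 := by rw [← hCS]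
      _ = L ^ 4 * S ^ 2 := by noncomm_ring
      _ = L ^ 2 := e4
  have hc3 : L * S ^ 3 = S ^ 3 * L := hSC.pow_right 3
  have hF1 : L * (L ^ 2 * S ^ 3) = (L ^ 2 * S ^ 3) * L := by
    rw [mul_assoc (L ^ 2), ← hc3]; noncomm_ring
  have hF3 : L * (L * (L ^ 2 * S ^ 3 * L)) = L * L := by
    calc L * (L * (L ^ 2 * S ^ 3 * L)) = L * (L * (L ^ 2 * (L * S ^ 3))) := by
          rw [mul_assoc (L ^ 2), ← hc3]
      _ = L ^ 5 * S ^ 3 := by noncomm_ring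
      _ = L * L := by rw [h5, pow_two]
  have hF2 : (L ^ 2 * S ^ 3) * (L * (L ^ 2 * S ^ 3)) = L ^ 2 * S ^ 3 := by
    calc (L ^ 2 * S ^ 3) * (L * (L ^ 2 * S ^ 3)) = (L ^ 2 * (S ^ 3 * L ^ 3)) * S ^ 3 := by
          noncomm_ring
      _ = (L ^ 2 * (L ^ 3 * S ^ 3)) * S ^ 3 := by rw [((hSC.pow_pow 3 3).eq)]
      _ = (L ^ 5 * S ^ 3) * S ^ 3 := by noncomm_ring
      _ = L ^ 2 * S ^ 3 := by rw [h5]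
  refine ⟨LinearMap.toContinuousLinearMap (L ^ 2 * S ^ 3), fun x => ?_, fun x => ?_, fun x => ?_⟩
  · exact LinearMap.congr_fun hF1 x
  · exact LinearMap.congr_fun hF2 x
  · exact LinearMap.congr_fun hF3 x

end Drazin

/-! ### Carathéodory solutions of linear ODEs -/

section LinearODE

variable {W : Type*} [NormedAddCommGroup W] [NormedSpace ℝ W] [CompleteSpace W] {T : ℝ}

/-- Linear differential equations with an integrable right-hand side have Carathéodory solutions. -/
lemma exists_linear_ode_solution (G : W →L[ℝ] W) {h : ℝ → W} (hh : Integrable h (timeMeasure T))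
    (w₀ : W) : ∃ w : ℝ → W, Continuous w ∧
      ∀ t ∈ Icc 0 T, w t = w₀ + ∫ s in (0 : ℝ)..t, (G (w s) + h s) := by
  set e : ℝ → W := (Icc 0 T).indicator h with he
  have hei : Integrable e := (integrable_indicator_iff measurableSet_Icc).2 hh
  -- The solution is sought as `v + f`. The rough inhomogeneity is absorbed in `f`, so `v' = G (v +
  -- f)` has a continuous forcing term and is solved by variation of constants.
  set f : ℝ → W := fun t => w₀ + ∫ s in (0 : ℝ)..t, e s with hf
  have hfc : Continuous f := continuous_const.add
    (intervalIntegral.continuous_primitive (fun _ _ => hei.intervalIntegrable) 0)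
  set U : ℝ → W →L[ℝ] W := fun t => NormedSpace.exp (t • G) with hU
  have hUd : ∀ t, HasDerivAt U (G * U t) t := fun t => hasDerivAt_exp_smul_const' G t
  have hUc : Continuous U := continuous_iff_continuousAt.2 fun t => (hUd t).continuousAt
  have hUU : ∀ t, U t * U (-t) = 1 := fun t => by
    simp only [hU]
    rw [← NormedSpace.exp_add_of_commute_of_mem_ball (𝕂 := ℝ)
      (((Commute.refl G).smul_left t).smul_right (-t))
      ((NormedSpace.expSeries_radius_eq_top ℝ (W →L[ℝ] W)).symm ▸ edist_lt_top _ _)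
      ((NormedSpace.expSeries_radius_eq_top ℝ (W →L[ℝ] W)).symm ▸ edist_lt_top _ _)]
    simp
  set φ : ℝ → W := fun s => U (-s) (G (f s)) with hφ
  have hφc : Continuous φ := (hUc.comp continuous_neg).clm_apply (G.continuous.comp hfc)
  set v : ℝ → W := fun t => U t (∫ s in (0 : ℝ)..t, φ s) with hv
  have hvd : ∀ t, HasDerivAt v (G (v t + f t)) t := fun t => by
    have h1 : HasDerivAt (fun t => ∫ s in (0 : ℝ)..t, φ s) (φ t) t :=
      intervalIntegral.integral_hasDerivAt_right (hφc.intervalIntegrable _ _)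
        (hφc.stronglyMeasurableAtFilter _ _) hφc.continuousAt
    refine ((hUd t).clm_apply h1).congr_deriv ?_
    have : U t (φ t) = G (f t) := by
      change (U t * U (-t)) (G (f t)) = _
      rw [hUU]; rfl
    rw [this]
    exact (map_add G _ _).symm
  have hvc : Continuous v := continuous_iff_continuousAt.2 fun t => (hvd t).continuousAt
  refine ⟨fun t => v t + f t, hvc.add hfc, fun t ht => ?_⟩
  have hGc : Continuous fun s => G (v s + f s) := G.continuous.comp (hvc.add hfc)
  rw [intervalIntegral.integral_add (hGc.intervalIntegrable _ _)
    (intervalIntegrable_of_timeMeasure hh ht),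
    intervalIntegral.integral_eq_sub_of_hasDerivAt (fun s _ => hvd s) (hGc.intervalIntegrable _ _),
    ← intervalIntegral_indicator_Icc h ht]
  have hv0 : v 0 = 0 := by simp [hv]
  simp only [hv0, hf, sub_zero, ← he]
  abel

end LinearODE

/-! ### Differential-algebraic equations solved by a Drazin inverse -/

section DAE

variable {W : Type*} [NormedAddCommGroup W] [NormedSpace ℝ W] [FiniteDimensional ℝ W] {T : ℝ}

lemma MemLp.clm {U U' : Type*} [NormedAddCommGroup U] [NormedSpace ℝ U] [NormedAddCommGroup U']
    [NormedSpace ℝ U'] (L : U →L[ℝ] U') {f : ℝ → U} (hf : MemLp f 2 (timeMeasure T)) :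
    MemLp (fun t => L (f t)) 2 (timeMeasure T) := L.comp_memLp' hf

/-- Solvability of `d/dt C y = l C y - y + h` for an operator `C` with Drazin inverse `F`, if the
component of `h` in the kernel of `C ^ 2` is, after application of `C`, differentiable. -/
lemma exists_normalized_dae_solution (hT : 0 < T) {C F : W →L[ℝ] W} (l : ℝ)
    (hF₁ : ∀ x, C (F x) = F (C x)) (hF₂ : ∀ x, F (C (F x)) = F x)
    (hF₃ : ∀ x, C (C (F (C x))) = C (C x))
    {h e : ℝ → W} (hhm : MemLp h 2 (timeMeasure T)) (he : MemLp e 2 (timeMeasure T)) (y₀ : W)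
    (hD : IsPrim T (C y₀ - C (F (C y₀))) e (fun t => C (h t) - C (F (C (h t))))) :
    ∃ y : ℝ → W, MemLp y 2 (timeMeasure T) ∧
      IsPrim T (C y₀) (fun t => l • C (y t) - y t + h t) (fun t => C (y t)) := by
  have : CompleteSpace W := FiniteDimensional.complete ℝ W
  have hint : ∀ {f : ℝ → W}, MemLp f 2 (timeMeasure T) → Integrable f (timeMeasure T) :=
    fun hf => hf.integrable (by norm_num)
  have hPm : MemLp (fun t => F (C (h t))) 2 (timeMeasure T) := MemLp.clm (F ∘L C) hhm
  -- With the projection `Π = F C`, the regular part `w = Π C y` must satisfy `w' = l w - F w + Π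
  -- h`, since `Π y = F w`.
  set G : W →L[ℝ] W := l • ContinuousLinearMap.id ℝ W - F with hG
  have hGx : ∀ x, G x = l • x - F x := fun _ => rfl
  obtain ⟨w, hwc, hw⟩ := exists_linear_ode_solution G (hint hPm) (C (F (C y₀)))
  have hwm : MemLp w 2 (timeMeasure T) := by
    obtain ⟨b, hb⟩ := (isCompact_Icc (a := (0 : ℝ)) (b := T)).exists_bound_of_continuousOn
      hwc.continuousOn
    refine MemLp.of_bound hwc.aestronglyMeasurable b ?_
    filter_upwards [ae_timeMeasure_mem] with t ht using hb t ht
  have hDm : MemLp (fun t => C (h t) - C (F (C (h t)))) 2 (timeMeasure T) :=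
    (MemLp.clm C hhm).sub (MemLp.clm C hPm)
  -- `C` annihilates the function whose derivative is `e`, hence also `e`.
  have hCe : ∀ᵐ t ∂timeMeasure T, C (e t) = 0 := by
    have h1 := hD.map (hint he) C
    have h2 : IsPrim T (0 : W) (fun _ => (0 : W)) (fun _ => 0) := by
      filter_upwards with t; simp
    refine (IsPrim.unique hT h1 (h2.congr EventuallyEq.rfl ?_ : IsPrim T (0 : W) (fun _ => 0) _)
      (hint (MemLp.clm C he)) (integrable_zero _ _ _)).2
    filter_upwards with t
    rw [map_sub, hF₃, sub_self]
  -- On the range of `1 - Π` one has `C² = 0`. Applying `C` to the equation there gives `C y = C h`,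
  -- and the equation itself then determines this part of `y` as `h - e + l C h`, with `h` replaced
  -- by its component `(1 - Π) h`.
  set y : ℝ → W := fun t => F (w t) + (h t - F (C (h t))) - e t + l • (C (h t) - C (F (C (h t))))
    with hy
  have hym : MemLp y 2 (timeMeasure T) :=
    (((MemLp.clm F hwm).add (hhm.sub hPm)).sub he).add (hDm.const_smul l)
  refine ⟨y, hym, ?_⟩
  have hwP : IsPrim T (C (F (C y₀))) (fun s => G (w s) + F (C (h s))) w := by
    filter_upwards [ae_timeMeasure_mem] with t ht using hw t ht
  have hwm' : MemLp (fun s => G (w s) + F (C (h s))) 2 (timeMeasure T) :=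
    (MemLp.clm G hwm).add hPm
  have h2 := (hwP.map (hint hwm') (C ∘L F)).add hD (hint (MemLp.clm (C ∘L F) hwm')) (hint he)
  have hCy : ∀ᵐ t ∂timeMeasure T, C (F (w t)) + (C (h t) - C (F (C (h t)))) = C (y t) := by
    filter_upwards [hCe] with t ht
    simp only [hy, map_add, map_sub, map_smul, ht, hF₃]
    module
  have e1 : ∀ x, C (F (F x)) = F x := fun x => by rw [hF₁, hF₂]
  have hdy : ∀ᵐ t ∂timeMeasure T,
      C (F (G (w t) + F (C (h t)))) + e t = l • C (y t) - y t + h t := by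
    filter_upwards [hCy] with t ht
    rw [← ht]
    simp only [hy, hGx, map_add, map_sub, map_smul, e1]
    module
  have h4 := h2.congr hdy hCy
  rwa [show (C ∘L F) (C (F (C y₀))) + (C y₀ - C (F (C y₀))) = C y₀ by
    simp only [ContinuousLinearMap.comp_apply, hF₂]
    abel] at h4

/-- A linear differential-algebraic equation `d/dt E y = A y + g` with a regular pencil of index at
most two is solvable if the hidden constraint is differentiable and consistent. Here `F` is a Drazin
inverse of `K' E`, where `K'` is the inverse of `l E - A`. -/
lemma exists_dae_solution (hT : 0 < T) {E A K' F : W →L[ℝ] W} {l : ℝ}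
    (hK : ∀ x, l • E (K' x) - A (K' x) = x) (hK' : ∀ x, K' (l • E x - A x) = x)
    (hF₁ : ∀ x, K' (E (F x)) = F (K' (E x))) (hF₂ : ∀ x, F (K' (E (F x))) = F x)
    (hF₃ : ∀ x, K' (E (K' (E (F (K' (E x)))))) = K' (E (K' (E x))))
    {g e : ℝ → W} (hg : MemLp g 2 (timeMeasure T)) (he : MemLp e 2 (timeMeasure T)) (y₀ : W)
    (hD : IsPrim T (K' (E y₀) - K' (E (F (K' (E y₀))))) e
      (fun t => K' (E (K' (g t))) - K' (E (F (K' (E (K' (g t)))))))) :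
    ∃ y : ℝ → W, MemLp y 2 (timeMeasure T) ∧
      IsPrim T (E y₀) (fun t => A (y t) + g t) (fun t => E (y t)) := by
  have : CompleteSpace W := FiniteDimensional.complete ℝ W
  -- Applying `K'` normalizes the equation, because `K' A = l K' E - 1`; applying `l E - A`
  -- afterwards undoes this.
  obtain ⟨y, hym, hy⟩ := exists_normalized_dae_solution hT (C := K' ∘L E) (F := F) l hF₁ hF₂ hF₃
    (MemLp.clm K' hg) he y₀ hD
  refine ⟨y, hym, ?_⟩
  have hd : ∀ t, l • (K' ∘L E) (y t) - y t + K' (g t) = K' (A (y t) + g t) := fun t => by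
    have h1 := hK' (y t)
    rw [map_sub, map_smul] at h1
    rw [map_add, ContinuousLinearMap.comp_apply]
    nth_rewrite 2 [← h1]
    abel
  simp only [hd] at hy
  have hsm : MemLp (fun t => K' (A (y t) + g t)) 2 (timeMeasure T) :=
    MemLp.clm K' ((MemLp.clm A hym).add hg)
  have h5 := hy.map (hsm.integrable (by norm_num)) (l • E - A)
  have hKK : ∀ x, (l • E - A) (K' x) = x := fun x => by simpa using hK x
  simpa only [ContinuousLinearMap.comp_apply, hKK] using h5

end DAE

/-! ### Semidefinite operators and solvability of dissipative equations -/

section Operators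

open scoped RealInnerProductSpace

variable {W : Type*} [NormedAddCommGroup W] [InnerProductSpace ℝ W]

/-- The form is evaluated at `x - M⁻¹ S x`; the summand `1` keeps `M` positive even for `S = 0`.
This bound turns convergence of energies into convergence of `E x^k` and `R Q x^k`. -/
lemma norm_sq_le_of_symm_of_nonneg {S : W →L[ℝ] W} (hS : ∀ x y, ⟪S x, y⟫ = ⟪x, S y⟫)
    (hp : ∀ x, 0 ≤ ⟪S x, x⟫) (x : W) : ‖S x‖ ^ 2 ≤ (‖S‖ + 1) * ⟪S x, x⟫ := by
  set M := ‖S‖ + 1 with hM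
  have hM0 : 0 < M := by positivity
  have h1 := hp (x - M⁻¹ • S x)
  have h2 : ⟪S (S x), S x⟫ ≤ M * ‖S x‖ ^ 2 := by
    calc ⟪S (S x), S x⟫ ≤ ‖S (S x)‖ * ‖S x‖ := real_inner_le_norm _ _
      _ ≤ (‖S‖ * ‖S x‖) * ‖S x‖ := by gcongr; exact S.le_opNorm _
      _ = ‖S‖ * ‖S x‖ ^ 2 := by ring
      _ ≤ M * ‖S x‖ ^ 2 := by gcongr; linarith
  have h3 : ⟪S (x - M⁻¹ • S x), x - M⁻¹ • S x⟫ =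
      ⟪S x, x⟫ - 2 * M⁻¹ * ‖S x‖ ^ 2 + M⁻¹ ^ 2 * ⟪S (S x), S x⟫ := by
    simp only [map_sub, map_smul, inner_sub_left, inner_sub_right, real_inner_smul_left,
      real_inner_smul_right, hS (S x) x, real_inner_self_eq_norm_sq]
    ring
  rw [h3] at h1
  have h4 : M⁻¹ ^ 2 * ⟪S (S x), S x⟫ ≤ M⁻¹ * ‖S x‖ ^ 2 := by
    calc M⁻¹ ^ 2 * ⟪S (S x), S x⟫ ≤ M⁻¹ ^ 2 * (M * ‖S x‖ ^ 2) := by gcongr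
      _ = M⁻¹ * ‖S x‖ ^ 2 := by field_simp
  have h5 : M⁻¹ * ‖S x‖ ^ 2 ≤ ⟪S x, x⟫ := by linarith
  calc ‖S x‖ ^ 2 = M * (M⁻¹ * ‖S x‖ ^ 2) := by field_simp
    _ ≤ M * ⟪S x, x⟫ := by gcongr

lemma eq_zero_of_inner_nonpos {S : W →L[ℝ] W} (hS : ∀ x y, ⟪S x, y⟫ = ⟪x, S y⟫)
    (hp : ∀ x, 0 ≤ ⟪S x, x⟫) {x : W} (hx : ⟪S x, x⟫ ≤ 0) : S x = 0 := by
  have h := norm_sq_le_of_symm_of_nonneg hS hp x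
  have h1 : ⟪S x, x⟫ = 0 := le_antisymm hx (hp x)
  rw [h1, mul_zero] at h
  exact norm_eq_zero.1 (pow_eq_zero_iff two_ne_zero |>.1 (le_antisymm h (sq_nonneg _)))

variable [FiniteDimensional ℝ W]

/-- A symmetric operator has index at most one, so its Drazin inverse `F` satisfies `S F S = S`;
averaging `F` with its adjoint makes it symmetric. The purpose is `⟨S a, a⟩ = ⟨S a, P (S a)⟩`, which
depends on `S a` alone. -/
lemma exists_symm_generalized_inverse {S : W →L[ℝ] W} (hS : ∀ x y, ⟪S x, y⟫ = ⟪x, S y⟫) :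
    ∃ P : W →L[ℝ] W, (∀ x y, ⟪P x, y⟫ = ⟪x, P y⟫) ∧ ∀ x, S (P (S x)) = S x := by
  have : CompleteSpace W := FiniteDimensional.complete ℝ W
  have hker : ∀ x, S (S x) = 0 → S x = 0 := fun x hx => by
    rw [← inner_self_eq_zero (𝕜 := ℝ), hS, hx, inner_zero_right]
  obtain ⟨F, _, _, hF⟩ := exists_drazin_inverse S fun x hx => hker _ hx
  have hSF : ∀ x, S (F (S x)) = S x := fun x => by
    have := hker (F (S x) - x) (by rw [map_sub, map_sub, hF, sub_self])
    rwa [map_sub, sub_eq_zero] at this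
  refine ⟨(2⁻¹ : ℝ) • (F + ContinuousLinearMap.adjoint F), fun x y => ?_, fun x => ?_⟩
  · simp only [smul_apply, add_apply, real_inner_smul_left,
      real_inner_smul_right, inner_add_left, inner_add_right,
      ContinuousLinearMap.adjoint_inner_left, ContinuousLinearMap.adjoint_inner_right]
    ring
  · have h2 : S (ContinuousLinearMap.adjoint F (S x)) = S x := by
      refine ext_inner_right ℝ fun y => ?_
      rw [hS, ContinuousLinearMap.adjoint_inner_left, hS, hSF, ← hS]
    simp only [smul_apply, add_apply, map_smul, map_add, hSF, h2]
    module

lemma exists_clm_inverse {K : W →L[ℝ] W} (hK : ∀ x, K x = 0 → x = 0) :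
    ∃ K' : W →L[ℝ] W, (∀ x, K (K' x) = x) ∧ ∀ x, K' (K x) = x := by
  have hinj : Function.Injective (K : W →ₗ[ℝ] W) :=
    (injective_iff_map_eq_zero (K : W →ₗ[ℝ] W)).2 hK
  let e := LinearEquiv.ofInjectiveEndo (K : W →ₗ[ℝ] W) hinj
  exact ⟨LinearMap.toContinuousLinearMap (e.symm : W →ₗ[ℝ] W),
    fun x => e.apply_symm_apply x, fun x => e.symm_apply_apply x⟩

variable {T : ℝ}

/-- Solvability of `d/dt S y = A y + g` if `l S - A` has positive definite symmetric part. -/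
lemma exists_dae_solution_of_pos (hT : 0 < T) {S A : W →L[ℝ] W} {l : ℝ}
    (hS : ∀ x y, ⟪S x, y⟫ = ⟪x, S y⟫) (hpos : ∀ x, x ≠ 0 → 0 < ⟪l • S x - A x, x⟫)
    {g : ℝ → W} (hg : MemLp g 2 (timeMeasure T)) (y₀ : W) :
    ∃ y : ℝ → W, MemLp y 2 (timeMeasure T) ∧
      IsPrim T (S y₀) (fun t => A (y t) + g t) (fun t => S (y t)) := by
  have hK0 : ∀ x, (l • S - A) x = 0 → x = 0 := fun x hx => by
    by_contra hne
    have := hpos x hne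
    rw [show l • S x - A x = 0 from hx, inner_zero_left] at this
    exact lt_irrefl _ this
  obtain ⟨K', hK, hK'⟩ := exists_clm_inverse hK0
  -- Index at most one: `y = K' S x` has `S y = 0`, so pairing `(l S - A) y = S x` with `y` gives
  -- zero, which positivity allows only for `y = 0`.
  have hker : ∀ x, K' (S (K' (S x))) = 0 → K' (S x) = 0 := fun x hx => by
    have h1 : S (K' (S x)) = 0 := by rw [← hK (S (K' (S x))), hx, map_zero]
    by_contra hne
    have := hpos _ hne
    rw [show l • S (K' (S x)) - A (K' (S x)) = S x from hK (S x), hS, h1, inner_zero_right] at this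
    exact lt_irrefl _ this
  obtain ⟨F, hF₁, hF₂, hF₃⟩ := exists_drazin_inverse (K' ∘L S) fun x hx => hker _ hx
  simp only [ContinuousLinearMap.comp_apply] at hF₁ hF₂ hF₃
  -- Thus the hidden constraint is void, and `e = 0` serves.
  have hD : ∀ x, K' (S x) - K' (S (F (K' (S x)))) = 0 := fun x => by
    have h1 := hker (x - F (K' (S x))) (by simp only [map_sub, hF₃, sub_self])
    simpa only [map_sub] using h1
  refine exists_dae_solution hT hK hK' hF₁ hF₂ hF₃ hg (MemLp.zero' (ε := W)) y₀ ?_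
  filter_upwards with t
  simp [hD]

/-- Solvability of the port-Hamiltonian equation `d/dt S y = (J - R) y + g`. The hypothesis
`hcons` expresses regularity and consistency of the hidden constraints. -/
lemma exists_port_hamiltonian_solution (hT : 0 < T) {S R J : W →L[ℝ] W}
    (hS : ∀ x y, ⟪S x, y⟫ = ⟪x, S y⟫) (hSp : ∀ x, 0 ≤ ⟪S x, x⟫)
    (hR : ∀ x y, ⟪R x, y⟫ = ⟪x, R y⟫) (hRp : ∀ x, 0 ≤ ⟪R x, x⟫)
    (hJ : ∀ x y, ⟪J x, y⟫ = -⟪x, J y⟫) (hker : ∀ x, S x = 0 → R x = 0 → J x = 0 → x = 0)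
    {g : ℝ → W} (hg : MemLp g 2 (timeMeasure T)) (y₀ : W)
    (hcons : ∀ L : W →L[ℝ] W,
      (∀ z, S (ContinuousLinearMap.adjoint L z) = 0 ∧ R (ContinuousLinearMap.adjoint L z) = 0 ∧
        ∃ w, J (ContinuousLinearMap.adjoint L z) = S w) →
      ∃ e : ℝ → W, MemLp e 2 (timeMeasure T) ∧ IsPrim T (-L (J y₀)) e (fun t => L (g t))) :
    ∃ y : ℝ → W, MemLp y 2 (timeMeasure T) ∧
      IsPrim T (S y₀) (fun t => (J - R) (y t) + g t) (fun t => S (y t)) := by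
  have : CompleteSpace W := FiniteDimensional.complete ℝ W
  have hJ0 : ∀ x, ⟪J x, x⟫ = 0 := fun x => by
    have := hJ x x
    rw [real_inner_comm] at this
    linarith [real_inner_comm x (J x)]
  have hKin : ∀ x, ⟪S x - (J x - R x), x⟫ = ⟪S x, x⟫ + ⟪R x, x⟫ := fun x => by
    simp only [inner_sub_left, hJ0]; ring
  have hnull : ∀ x, ⟪S x - (J x - R x), x⟫ ≤ 0 → S x = 0 ∧ R x = 0 := fun x hx => by
    rw [hKin] at hx
    exact ⟨eq_zero_of_inner_nonpos hS hSp (by linarith [hRp x]),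
      eq_zero_of_inner_nonpos hR hRp (by linarith [hSp x])⟩
  have hKx : ∀ x, ((1 : ℝ) • S - (J - R)) x = S x - (J x - R x) := fun x => by simp
  have hK0 : ∀ x, ((1 : ℝ) • S - (J - R)) x = 0 → x = 0 := fun x hx => by
    rw [hKx] at hx
    obtain ⟨h1, h2⟩ := hnull x (by rw [hx, inner_zero_left])
    refine hker x h1 h2 ?_
    simpa [h1, h2] using hx
  obtain ⟨K', hK, hK'⟩ := exists_clm_inverse hK0
  have hKK : ∀ x, S (K' x) - (J (K' x) - R (K' x)) = x := fun x => (hKx _).symm.trans (hK x)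
  have hK'0 : ∀ x, K' x = 0 → x = 0 := fun x hx => by rw [← hK x, hx, map_zero]
  -- Index at most two. With `K = S - (J - R)` one has `K p = S x`, `K q = S p` and `S q = 0`.
  -- Pairing both equations with `q` gives `R q = 0` and `⟨J p, q⟩ = 0`; then `S p = -J q` is
  -- orthogonal to `p`, so `S p = 0`.
  have hidx : ∀ x, K' (S (K' (S (K' (S x))))) = 0 → K' (S (K' (S x))) = 0 := fun x hx => by
    set p := K' (S x) with hp
    set q := K' (S p) with hq
    have hSq : S q = 0 := hK'0 _ hx
    have hKq : S q - (J q - R q) = S p := hKK (S p)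
    have hKp : S p - (J p - R p) = S x := hKK (S x)
    obtain ⟨-, hRq⟩ := hnull q (by rw [hKq, hS, hSq, inner_zero_right])
    have h1 : ⟪S p - (J p - R p), q⟫ = 0 := by rw [hKp, hS, hSq, inner_zero_right]
    have h2 : ⟪J p, q⟫ = 0 := by
      simp only [inner_sub_left, hS p q, hR p q, hSq, hRq, inner_zero_right] at h1
      linarith
    have h3 : S p = 0 := by
      refine eq_zero_of_inner_nonpos hS hSp ?_
      rw [← hKq, hSq, hRq, sub_zero, zero_sub, inner_neg_left, hJ, neg_neg, real_inner_comm, h2]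
    rw [hq, h3, map_zero]
  obtain ⟨F, hF₁, hF₂, hF₃⟩ := exists_drazin_inverse (K' ∘L S) hidx
  simp only [ContinuousLinearMap.comp_apply] at hF₁ hF₂ hF₃
  -- `L g` is precisely the part of the data that has to be differentiated.
  set L : W →L[ℝ] W := (K' ∘L S - K' ∘L S ∘L F ∘L K' ∘L S) ∘L K' with hL
  have hLx : ∀ x, L x = K' (S (K' x)) - K' (S (F (K' (S (K' x))))) := fun x => rfl
  have hLS : ∀ x, L (S x) = 0 := fun x => by
    rw [hLx, ← hF₁, hF₃, sub_self]
  have hLJR : ∀ x, L (J x) - L (R x) = -(K' (S x) - K' (S (F (K' (S x))))) := fun x => by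
    have h1 : L (S x - (J x - R x)) = K' (S x) - K' (S (F (K' (S x)))) := by
      rw [hLx, ← hKx, hK']
    rw [← h1, map_sub, hLS, map_sub, zero_sub, neg_neg]
  have hmem : ∀ z, S (ContinuousLinearMap.adjoint L z) = 0 ∧
      R (ContinuousLinearMap.adjoint L z) = 0 ∧ ∃ w, J (ContinuousLinearMap.adjoint L z) = S w := by
    intro z
    set v := ContinuousLinearMap.adjoint L z with hv
    have hvx : ∀ x, ⟪v, x⟫ = ⟪z, L x⟫ := fun x => ContinuousLinearMap.adjoint_inner_left _ _ _
    have hSv : S v = 0 := by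
      refine ext_inner_right ℝ fun y => ?_
      rw [hS, hvx, hLS, inner_zero_right, inner_zero_left]
    -- By `hLJR`, the operator `L (J - R)` factors through `S` on the right; taking adjoints gives
    -- `J v + R v = S p`. Pairing with `v` then yields `R v = 0`.
    set p := ContinuousLinearMap.adjoint (K' - K' ∘L S ∘L F ∘L K') z with hp
    have hvK : J v + R v = S p := by
      refine ext_inner_right ℝ fun y => ?_
      rw [hS p, hp, ContinuousLinearMap.adjoint_inner_left, inner_add_left, hJ, hR, hvx, hvx]
      have h1 := hLJR y
      have h2 : (K' - K' ∘L S ∘L F ∘L K') (S y) = K' (S y) - K' (S (F (K' (S y)))) := rfl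
      rw [h2, ← neg_neg (_ - _), ← h1, inner_neg_right, inner_sub_right]
      ring
    have hRv : R v = 0 := by
      refine eq_zero_of_inner_nonpos hR hRp (le_of_eq ?_)
      have : ⟪J v + R v, v⟫ = 0 := by rw [hvK, hS, hSv, inner_zero_right]
      rwa [inner_add_left, hJ0, zero_add] at this
    exact ⟨hSv, hRv, p, by rw [← hvK, hRv, add_zero]⟩
  obtain ⟨e, he, hprim⟩ := hcons L hmem
  have hLR : L (R y₀) = 0 := by
    refine ext_inner_left ℝ fun z => ?_
    rw [← ContinuousLinearMap.adjoint_inner_left, ← hR, (hmem z).2.1, inner_zero_left,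
      inner_zero_right]
  have h0 := hLJR y₀
  rw [hLR, sub_zero] at h0
  rw [h0, neg_neg] at hprim
  exact exists_dae_solution hT hK hK' hF₁ hF₂ hF₃ hg he y₀ hprim

end Operators

/-! ### Weighted integrals -/

section WeightedIntegral

/-- The weighted integral `∫₀ᵗ e^{-2sω} φ(s) ds`. -/
noncomputable def wint (ω t : ℝ) (φ : ℝ → ℝ) : ℝ := ∫ s in (0 : ℝ)..t, Real.exp (-2 * s * ω) * φ s

variable {T t : ℝ} {φ ψ : ℝ → ℝ}

lemma integrable_exp_mul (hφ : Integrable φ (timeMeasure T)) (ω : ℝ) :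
    Integrable (fun s => Real.exp (-2 * s * ω) * φ s) (timeMeasure T) :=
  integrable_test_smul hφ (φ := fun s => Real.exp (-2 * s * ω)) (by fun_prop)

lemma intervalIntegrable_exp_mul (hφ : Integrable φ (timeMeasure T)) (ω : ℝ) (ht : t ∈ Icc 0 T) :
    IntervalIntegrable (fun s => Real.exp (-2 * s * ω) * φ s) volume 0 t :=
  intervalIntegrable_of_timeMeasure (integrable_exp_mul hφ ω) ht

lemma wint_add (hφ : Integrable φ (timeMeasure T)) (hψ : Integrable ψ (timeMeasure T)) (ω : ℝ)
    (ht : t ∈ Icc 0 T) : wint ω t (fun s => φ s + ψ s) = wint ω t φ + wint ω t ψ := by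
  simp only [wint, mul_add]
  exact intervalIntegral.integral_add (intervalIntegrable_exp_mul hφ ω ht)
    (intervalIntegrable_exp_mul hψ ω ht)

lemma wint_const_mul (c ω t : ℝ) (φ : ℝ → ℝ) : wint ω t (fun s => c * φ s) = c * wint ω t φ := by
  simp only [wint, mul_left_comm _ c]
  exact intervalIntegral.integral_const_mul _ _

lemma wint_congr (h : φ =ᵐ[timeMeasure T] ψ) (ω : ℝ) (ht : t ∈ Icc 0 T) :
    wint ω t φ = wint ω t ψ := by
  refine integral_congr_of_timeMeasure ?_ ht
  filter_upwards [h] with s hs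
  rw [hs]

lemma wint_nonneg (h : ∀ s, 0 ≤ φ s) (ω : ℝ) (ht : 0 ≤ t) : 0 ≤ wint ω t φ :=
  intervalIntegral.integral_nonneg ht fun s _ => mul_nonneg (Real.exp_pos _).le (h s)

lemma wint_mono (hφ : Integrable φ (timeMeasure T)) (hψ : Integrable ψ (timeMeasure T))
    (h : ∀ s, φ s ≤ ψ s) (ω : ℝ) (ht : t ∈ Icc 0 T) : wint ω t φ ≤ wint ω t ψ :=
  intervalIntegral.integral_mono_on ht.1 (intervalIntegrable_exp_mul hφ ω ht)
    (intervalIntegrable_exp_mul hψ ω ht) fun s _ =>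
      mul_le_mul_of_nonneg_left (h s) (Real.exp_pos _).le

lemma integral_le_exp_mul_wint (hT : 0 ≤ T) (hφ : Integrable φ (timeMeasure T))
    (h : ∀ s, 0 ≤ φ s) {ω : ℝ} (hω : 0 ≤ ω) :
    ∫ s in Icc 0 T, φ s ≤ Real.exp (2 * T * ω) * wint ω T φ := by
  rw [wint, intervalIntegral.integral_of_le hT, ← integral_Icc_eq_integral_Ioc,
    ← integral_const_mul]
  refine setIntegral_mono_on hφ ((integrable_exp_mul hφ ω).const_mul _) measurableSet_Icc
    fun s hs => ?_
  rw [← mul_assoc, ← Real.exp_add]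
  refine le_mul_of_one_le_left (h s) (Real.one_le_exp ?_)
  nlinarith [hs.2]

lemma ae_eq_zero_of_wint_nonpos (hT : 0 ≤ T) (hφ : Integrable φ (timeMeasure T))
    (h : ∀ s, 0 ≤ φ s) {ω : ℝ} (hω : 0 ≤ ω) (h0 : wint ω T φ ≤ 0) :
    ∀ᵐ s ∂timeMeasure T, φ s = 0 := by
  have h1 := integral_le_exp_mul_wint hT hφ h hω
  have h2 : ∫ s in Icc 0 T, φ s = 0 := le_antisymm
    (h1.trans (mul_nonpos_of_nonneg_of_nonpos (Real.exp_pos _).le h0)) (integral_nonneg h)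
  exact (integral_eq_zero_iff_of_nonneg h hφ).1 h2

end WeightedIntegral

/-! ### Monotone operators in weighted integrals -/

section Monotone

open scoped RealInnerProductSpace

variable {W : Type*} [NormedAddCommGroup W] [InnerProductSpace ℝ W] {T : ℝ}

lemma MemLp.integrable_real_inner {f g : ℝ → W} (hf : MemLp f 2 (timeMeasure T))
    (hg : MemLp g 2 (timeMeasure T)) : Integrable (fun t => ⟪f t, g t⟫) (timeMeasure T) := by
  refine (L2.integrable_inner (𝕜 := ℝ) (hf.toLp f) (hg.toLp g)).congr ?_
  filter_upwards [hf.coeFn_toLp, hg.coeFn_toLp] with t h1 h2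
  rw [h1, h2]

lemma MemLp.integrable_norm_sq {f : ℝ → W} (hf : MemLp f 2 (timeMeasure T)) :
    Integrable (fun t => ‖f t‖ ^ 2) (timeMeasure T) := by
  simpa only [real_inner_self_eq_norm_sq] using MemLp.integrable_real_inner hf hf

/-- The energy balance for `d/dt S a = d`, `S a(0) = 0`; `q` is the energy `⟪S a, a⟫` at all
points of the interval. -/
lemma exists_energy [FiniteDimensional ℝ W] (hT : 0 < T) {S : W →L[ℝ] W}
    (hS : ∀ x y, ⟪S x, y⟫ = ⟪x, S y⟫) (hSp : ∀ x, 0 ≤ ⟪S x, x⟫) {d a : ℝ → W}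
    (hd : MemLp d 2 (timeMeasure T)) (ha : MemLp a 2 (timeMeasure T))
    (h : IsPrim T 0 d (fun t => S (a t))) :
    ∃ q : ℝ → ℝ, (∀ t ∈ Icc 0 T, ‖∫ s in (0 : ℝ)..t, d s‖ ^ 2 ≤ (‖S‖ + 1) * q t) ∧
      ∀ ω, ∀ t ∈ Icc 0 T, wint ω t (fun s => ⟪d s, a s⟫) =
        1 / 2 * (Real.exp (-2 * t * ω) * q t) + ω * wint ω t (fun s => ⟪S (a s), a s⟫) := by
  have : CompleteSpace W := FiniteDimensional.complete ℝ W
  obtain ⟨P, hP, hSP⟩ := exists_symm_generalized_inverse hS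
  have hdi : Integrable d (timeMeasure T) := hd.integrable (by norm_num)
  -- `S P` fixes `S a`, hence also its derivative `d`.
  have hd' : ∀ᵐ t ∂timeMeasure T, S (P (d t)) = d t := by
    have h1 := h.map hdi (S ∘L P)
    simp only [ContinuousLinearMap.comp_apply, hSP] at h1
    exact (h1.unique hT h ((MemLp.clm (S ∘L P) hd).integrable (by norm_num)) hdi).2
  set Y : ℝ → W := fun t => ∫ s in (0 : ℝ)..t, d s with hY
  refine ⟨fun t => ⟪Y t, P (Y t)⟫, fun t ht => ?_, fun ω t ht => ?_⟩
  · have h1 : S (P (Y t)) = Y t := by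
      change (S ∘L P) (Y t) = Y t
      rw [hY]
      simp only
      rw [← ContinuousLinearMap.intervalIntegral_comp_comm _
        (intervalIntegrable_of_timeMeasure hdi ht)]
      exact integral_congr_of_timeMeasure hd' ht
    have h2 := norm_sq_le_of_symm_of_nonneg hS hSp (P (Y t))
    rwa [h1] at h2
  · have hE := exp_mul_inner_prim hdi P hP ω ht
    have hae : (fun s => 2 * ⟪d s, P (Y s)⟫ - 2 * ω * ⟪Y s, P (Y s)⟫) =ᵐ[timeMeasure T]
        fun s => 2 * ⟪d s, a s⟫ + (-2 * ω) * ⟪S (a s), a s⟫ := by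
      filter_upwards [h, hd'] with s h1 h2
      rw [zero_add] at h1
      have e1 : ⟪d s, P (Y s)⟫ = ⟪d s, a s⟫ := by
        rw [← hP]
        change ⟪P (d s), ∫ r in (0 : ℝ)..s, d r⟫ = _
        rw [← h1, ← hS, h2]
      have e2 : ⟪Y s, P (Y s)⟫ = ⟪S (a s), a s⟫ := by
        change ⟪∫ r in (0 : ℝ)..s, d r, P (∫ r in (0 : ℝ)..s, d r)⟫ = _
        rw [← h1, hS, hSP, hS]
      rw [e1, e2]
      ring
    have hi1 := MemLp.integrable_real_inner hd ha
    have hi2 := MemLp.integrable_real_inner (MemLp.clm S ha) ha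
    change Real.exp (-2 * t * ω) * ⟪Y t, P (Y t)⟫ =
      wint ω t (fun s => 2 * ⟪d s, P (Y s)⟫ - 2 * ω * ⟪Y s, P (Y s)⟫) at hE
    rw [wint_congr hae ω ht, wint_add (hi1.const_mul 2) (hi2.const_mul _) ω ht, wint_const_mul,
      wint_const_mul] at hE
    simp only
    linarith

/-- One step of the Lions–Mercier iteration decreases the weighted distance. -/
lemma wint_norm_sq_step {a b p a' b' : ℝ → W} (ha : MemLp a 2 (timeMeasure T))
    (hb : MemLp b 2 (timeMeasure T)) (hp : MemLp p 2 (timeMeasure T)) {N : W →L[ℝ] W}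
    (hN : ∀ x, 0 ≤ ⟪N x, x⟫) {lam : ℝ} (hlam : 0 ≤ lam)
    (h₁ : ∀ᵐ t ∂timeMeasure T, a t - lam • b t = p t + lam • N (p t))
    (h₂ : ∀ᵐ t ∂timeMeasure T, a' t + lam • b' t = p t - lam • N (p t))
    (ω : ℝ) {t : ℝ} (ht : t ∈ Icc 0 T) :
    wint ω t (fun s => ‖a' s + lam • b' s‖ ^ 2) ≤
      wint ω t (fun s => ‖a s + lam • b s‖ ^ 2) - 4 * lam * wint ω t (fun s => ⟪a s, b s⟫) := by
  have hi1 : Integrable (fun s => ‖a s + lam • b s‖ ^ 2) (timeMeasure T) :=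
    MemLp.integrable_norm_sq (ha.add (hb.const_smul lam))
  have hi2 := MemLp.integrable_real_inner ha hb
  have hNp := (MemLp.clm N hp).const_smul lam
  -- Both sides are the integral of `‖a - λ b‖²`. The remaining comparison of `p - λ N p` with `p +
  -- λ N p` is the monotonicity of `N`.
  have e : wint ω t (fun s => ‖a s + lam • b s‖ ^ 2) - 4 * lam * wint ω t (fun s => ⟪a s, b s⟫) =
      wint ω t (fun s => ‖p s + lam • N (p s)‖ ^ 2) := by
    rw [sub_eq_add_neg, ← neg_mul, ← wint_const_mul, ← wint_add hi1 (hi2.const_mul _) ω ht]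
    refine wint_congr ?_ ω ht
    filter_upwards [h₁] with s hs
    rw [← hs, norm_add_sq_real, norm_sub_sq_real, real_inner_smul_right]
    ring
  have e' : wint ω t (fun s => ‖a' s + lam • b' s‖ ^ 2) =
      wint ω t (fun s => ‖p s - lam • N (p s)‖ ^ 2) := by
    refine wint_congr ?_ ω ht
    filter_upwards [h₂] with s hs
    rw [hs]
  rw [e, e']
  refine wint_mono (MemLp.integrable_norm_sq (hp.sub hNp)) (MemLp.integrable_norm_sq (hp.add hNp))
    (fun s => ?_) ω ht
  simp only [Pi.add_apply, Pi.sub_apply, Pi.smul_apply]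
  rw [norm_add_sq_real, norm_sub_sq_real, real_inner_smul_right, real_inner_comm]
  nlinarith [mul_nonneg hlam (hN (p s))]

/-- A monotone `b` makes `a` no larger than `a + lam • b` in the weighted norm. -/
lemma wint_norm_sq_le {a b : ℝ → W} (ha : MemLp a 2 (timeMeasure T))
    (hb : MemLp b 2 (timeMeasure T)) {lam : ℝ} (hlam : 0 ≤ lam) (ω : ℝ) {t : ℝ} (ht : t ∈ Icc 0 T)
    (hab : 0 ≤ wint ω t (fun s => ⟪a s, b s⟫)) :
    wint ω t (fun s => ‖a s‖ ^ 2) ≤ wint ω t (fun s => ‖a s + lam • b s‖ ^ 2) := by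
  have hi := MemLp.integrable_norm_sq ha
  have hi2 := (MemLp.integrable_real_inner ha hb).const_mul (2 * lam)
  calc wint ω t (fun s => ‖a s‖ ^ 2)
      ≤ wint ω t (fun s => ‖a s‖ ^ 2) + 2 * lam * wint ω t (fun s => ⟪a s, b s⟫) := by
        have := mul_nonneg (mul_nonneg zero_le_two hlam) hab
        linarith
    _ = wint ω t (fun s => ‖a s‖ ^ 2 + 2 * lam * ⟪a s, b s⟫) := by
        rw [wint_add hi hi2 ω ht, wint_const_mul]
    _ ≤ wint ω t (fun s => ‖a s + lam • b s‖ ^ 2) := by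
        refine wint_mono (hi.add hi2)
          (MemLp.integrable_norm_sq (ha.add (hb.const_smul lam))) (fun s => ?_) ω ht
        simp only [Pi.add_apply, Pi.smul_apply]
        rw [norm_add_sq_real, real_inner_smul_right]
        nlinarith [sq_nonneg ‖lam • b s‖]

end Monotone

/-- `S` decreases and is bounded below, so its increments tend to zero, and they dominate `c * I`.
-/
lemma tendsto_zero_of_le_sub {S I : ℕ → ℝ} {c : ℝ} (hc : 0 < c) (hS : ∀ k, 0 ≤ S k)
    (hI : ∀ k, 0 ≤ I k) (h : ∀ k, S (k + 1) ≤ S k - c * I k) : Tendsto I atTop (𝓝 0) := by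
  have hanti : Antitone S := antitone_nat_of_succ_le fun k => by
    linarith [h k, mul_nonneg hc.le (hI k)]
  have hlim : Tendsto S atTop (𝓝 (⨅ k, S k)) :=
    tendsto_atTop_ciInf hanti ⟨0, by rintro _ ⟨k, rfl⟩; exact hS k⟩
  have h1 : Tendsto (fun k => c⁻¹ * (S k - S (k + 1))) atTop (𝓝 0) := by
    simpa using (hlim.sub (hlim.comp (tendsto_add_atTop_nat 1))).const_mul c⁻¹
  refine squeeze_zero hI (fun k => ?_) h1
  rw [le_inv_mul_iff₀ hc]
  linarith [h k]

lemma tendsto_zero_of_norm_sq_le {T : ℝ} (hT : 0 ≤ T) {κ : Type} [Fintype κ] {f : ℕ → L2 T κ}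
    {φ : ℕ → ℝ → ℝ} {c ω : ℝ} (hω : 0 ≤ ω) (hc : 0 ≤ c) (hφ : ∀ k, Integrable (φ k) (timeMeasure T))
    (hφ0 : ∀ k s, 0 ≤ φ k s) (h : ∀ k, ∀ᵐ s ∂timeMeasure T, ‖f k s‖ ^ 2 ≤ c * φ k s)
    (hlim : Tendsto (fun k => wint ω T (φ k)) atTop (𝓝 0)) : Tendsto f atTop (𝓝 0) := by
  rw [tendsto_zero_iff_norm_tendsto_zero]
  have hsq : ∀ k, ‖f k‖ ^ 2 ≤ c * (Real.exp (2 * T * ω) * wint ω T (φ k)) := fun k => by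
    rw [← real_inner_self_eq_norm_sq, L2.inner_def]
    simp only [real_inner_self_eq_norm_sq]
    calc ∫ s in Icc 0 T, ‖f k s‖ ^ 2 ≤ ∫ s in Icc 0 T, c * φ k s :=
          integral_mono_ae (MemLp.integrable_norm_sq (Lp.memLp (f k))) ((hφ k).const_mul c) (h k)
      _ = c * ∫ s in Icc 0 T, φ k s := integral_const_mul _ _
      _ ≤ _ := mul_le_mul_of_nonneg_left (integral_le_exp_mul_wint hT (hφ k) (hφ0 k) hω) hc
  have h2 : Tendsto (fun k => ‖f k‖ ^ 2) atTop (𝓝 0) := by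
    refine squeeze_zero (fun k => sq_nonneg _) hsq ?_
    simpa using (hlim.const_mul (Real.exp (2 * T * ω))).const_mul c
  simpa using h2.sqrt

/-! ### Constant matrices as operators -/

section MatrixOperators

open scoped RealInnerProductSpace
open Matrix

variable {ι κ τ : Type} [Fintype ι] [Fintype κ] [DecidableEq κ] [Fintype τ] [DecidableEq τ]

lemma matCLM_ofLp (A : Matrix ι κ ℝ) (x : EuclideanSpace ℝ κ) :
    (matCLM A x).ofLp = A *ᵥ x.ofLp := rfl

lemma matCLM_mul (A : Matrix ι κ ℝ) (B : Matrix κ τ ℝ) (x : EuclideanSpace ℝ τ) :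
    matCLM (A * B) x = matCLM A (matCLM B x) :=
  WithLp.ofLp_injective 2 (mulVec_mulVec _ A B).symm

lemma matCLM_one (x : EuclideanSpace ℝ κ) : matCLM (1 : Matrix κ κ ℝ) x = x :=
  WithLp.ofLp_injective 2 (one_mulVec _)

lemma matCLM_add (A B : Matrix ι κ ℝ) : matCLM (A + B) = matCLM A + matCLM B :=
  ContinuousLinearMap.ext fun _ => WithLp.ofLp_injective 2 (add_mulVec _ _ _)

lemma matCLM_sub (A B : Matrix ι κ ℝ) : matCLM (A - B) = matCLM A - matCLM B :=
  ContinuousLinearMap.ext fun _ => WithLp.ofLp_injective 2 (sub_mulVec _ _ _)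

lemma matCLM_neg (A : Matrix ι κ ℝ) (x : EuclideanSpace ℝ κ) : matCLM (-A) x = -matCLM A x :=
  WithLp.ofLp_injective 2 (neg_mulVec _ _)

lemma matCLM_smul (c : ℝ) (A : Matrix ι κ ℝ) : matCLM (c • A) = c • matCLM A :=
  ContinuousLinearMap.ext fun _ => WithLp.ofLp_injective 2 (smul_mulVec _ _ _)

lemma inner_eq_dotProduct {σ : Type} [Fintype σ] (x y : EuclideanSpace ℝ σ) :
    ⟪x, y⟫ = x.ofLp ⬝ᵥ y.ofLp := by
  rw [EuclideanSpace.inner_eq_star_dotProduct, star_trivial, dotProduct_comm]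

lemma inner_matCLM_left [DecidableEq ι] (A : Matrix ι κ ℝ) (x : EuclideanSpace ℝ κ)
    (y : EuclideanSpace ℝ ι) : ⟪matCLM A x, y⟫ = ⟪x, matCLM Aᵀ y⟫ := by
  rw [inner_eq_dotProduct, inner_eq_dotProduct, matCLM_ofLp, matCLM_ofLp, mulVec_transpose,
    dotProduct_comm x.ofLp, ← dotProduct_mulVec, dotProduct_comm]

lemma inner_matCLM_self_of_skew {A : Matrix κ κ ℝ}
    (h : Aᵀ = -A) (x : EuclideanSpace ℝ κ) : ⟪matCLM A x, x⟫ = 0 := by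
  have h1 := inner_matCLM_left A x x
  rw [h, matCLM_neg, inner_neg_right] at h1
  linarith [real_inner_comm x (matCLM A x)]

lemma exists_matCLM_eq (L : EuclideanSpace ℝ κ →L[ℝ] EuclideanSpace ℝ ι) :
    ∃ A : Matrix ι κ ℝ, matCLM A = L :=
  ⟨Matrix.toEuclideanLin.symm L, by
    rw [matCLM, LinearEquiv.apply_symm_apply]
    rfl⟩

variable {T : ℝ}

lemma matL2_ae (A : Matrix ι κ ℝ) (f : L2 T κ) :
    ∀ᵐ t ∂timeMeasure T, matL2 T A f t = matCLM A (f t) :=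
  (matCLM A).coeFn_compLpL f

lemma matL2_mul (A : Matrix ι κ ℝ) (B : Matrix κ τ ℝ) (f : L2 T τ) :
    matL2 T (A * B) f = matL2 T A (matL2 T B f) := by
  refine Lp.ext ?_
  filter_upwards [matL2_ae (A * B) f, matL2_ae A (matL2 T B f), matL2_ae B f] with t h1 h2 h3
  rw [h1, h2, h3, matCLM_mul]

lemma matL2_one (f : L2 T κ) : matL2 T (1 : Matrix κ κ ℝ) f = f := by
  refine Lp.ext ?_
  filter_upwards [matL2_ae (1 : Matrix κ κ ℝ) f] with t h1
  rw [h1, matCLM_one]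

lemma matL2_add (A B : Matrix ι κ ℝ) : matL2 T (A + B) = matL2 T A + matL2 T B := by
  rw [matL2, matCLM_add, ContinuousLinearMap.add_compLpL]
  rfl

lemma matL2_smul (c : ℝ) (A : Matrix ι κ ℝ) : matL2 T (c • A) = c • matL2 T A := by
  rw [matL2, matCLM_smul, ContinuousLinearMap.smul_compLpL]
  rfl

lemma matL2_sub (A B : Matrix ι κ ℝ) : matL2 T (A - B) = matL2 T A - matL2 T B := by
  rw [sub_eq_add_neg, ← neg_one_smul ℝ B, matL2_add, matL2_smul, neg_one_smul, sub_eq_add_neg]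

end MatrixOperators

/-! ### Structure of the coefficient matrices -/

namespace PHBlocks

open scoped RealInnerProductSpace
open Matrix

variable {s m : ℕ} {nn : Fin s → ℕ} {P : PHBlocks s nn m} {T : ℝ}
  {x₀ : EuclideanSpace ℝ (Idx nn)} {u : L2 T (Fin m)}

lemma blockDiagonal'_inner_nonneg {A : ∀ i, Matrix (Fin (nn i)) (Fin (nn i)) ℝ}
    (h : ∀ i, (A i).PosSemidef) (x : EuclideanSpace ℝ (Idx nn)) :
    0 ≤ ⟪matCLM (blockDiagonal' A) x, x⟫ := by
  rw [inner_eq_dotProduct, dotProduct_comm, matCLM_ofLp, dotProduct, Fintype.sum_sigma]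
  refine Finset.sum_nonneg fun i _ => ?_
  have h1 := (h i).dotProduct_mulVec_nonneg (fun j => x.ofLp ⟨i, j⟩)
  rw [star_trivial, dotProduct] at h1
  refine h1.trans_eq (Finset.sum_congr rfl fun j _ => ?_)
  congr 1
  simp only [mulVec, dotProduct, Fintype.sum_sigma]
  rw [Finset.sum_eq_single i]
  · simp [blockDiagonal'_apply_eq]
  · intro i' _ hi'
    refine Finset.sum_eq_zero fun j' _ => ?_
    rw [blockDiagonal'_apply_ne _ _ _ hi'.symm, zero_mul]
  · simp

lemma transpose_Jo (P : PHBlocks s nn m) : P.Joᵀ = -P.Jo := by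
  ext p q
  simp only [transpose_apply, Jo, of_apply]
  rcases lt_trichotomy p.1 q.1 with h | h | h
  · simp [h, h.not_gt]
  · simp [h]
  · simp [h, h.not_gt]

namespace Assumption

lemma Q_mul_inv (hP : P.Assumption T x₀ u) : P.Q * P.Q⁻¹ = 1 := by
  have h : P.Q * blockDiagonal' (fun i => (P.Qb i)⁻¹) = 1 := by
    rw [Q, ← blockDiagonal'_mul, ← blockDiagonal'_one]
    congr 1
    funext i
    exact mul_nonsing_inv _ ((isUnit_iff_isUnit_det _).1 (hP.Q_inv i))
  rw [inv_eq_right_inv h, h]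

lemma Q_inv_mul (hP : P.Assumption T x₀ u) : P.Q⁻¹ * P.Q = 1 := mul_eq_one_comm.1 hP.Q_mul_inv

lemma E_mul_inv_mul (hP : P.Assumption T x₀ u) : P.E * P.Q⁻¹ * P.Q = P.E := by
  rw [mul_assoc, hP.Q_inv_mul, mul_one]

lemma transpose_E_mul_Q (hP : P.Assumption T x₀ u) : P.Eᵀ * P.Q = P.Qᵀ * P.E := by
  simp only [E, Q, blockDiagonal'_transpose, ← blockDiagonal'_mul, hP.EQ_symm]

lemma transpose_energy (hP : P.Assumption T x₀ u) : (P.E * P.Q⁻¹)ᵀ = P.E * P.Q⁻¹ := by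
  have h : P.Q⁻¹ᵀ * P.Qᵀ = 1 := by rw [← transpose_mul, hP.Q_mul_inv, transpose_one]
  rw [transpose_mul]
  calc P.Q⁻¹ᵀ * P.Eᵀ = P.Q⁻¹ᵀ * (P.Eᵀ * P.Q) * P.Q⁻¹ := by
        rw [mul_assoc, mul_assoc, hP.Q_mul_inv, mul_one]
    _ = P.E * P.Q⁻¹ := by rw [hP.transpose_E_mul_Q, ← mul_assoc, h, one_mul]

lemma energy_symm (hP : P.Assumption T x₀ u) (x y : EuclideanSpace ℝ (Idx nn)) :
    ⟪matCLM (P.E * P.Q⁻¹) x, y⟫ = ⟪x, matCLM (P.E * P.Q⁻¹) y⟫ := by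
  rw [inner_matCLM_left, hP.transpose_energy]

lemma energy_nonneg (hP : P.Assumption T x₀ u) (x : EuclideanSpace ℝ (Idx nn)) :
    0 ≤ ⟪matCLM (P.E * P.Q⁻¹) x, x⟫ := by
  have h := blockDiagonal'_inner_nonneg hP.EQ_psd (matCLM P.Q⁻¹ x)
  have e : blockDiagonal' (fun i => (P.Eb i)ᵀ * P.Qb i) = P.Eᵀ * P.Q := by
    simp only [E, Q, blockDiagonal'_transpose, ← blockDiagonal'_mul]
  rw [e, hP.transpose_E_mul_Q, inner_matCLM_left, transpose_mul, transpose_transpose, matCLM_mul,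
    ← matCLM_mul P.Q, hP.Q_mul_inv, matCLM_one, ← inner_matCLM_left, ← matCLM_mul] at h
  exact h

lemma R_symm (hP : P.Assumption T x₀ u) (x y : EuclideanSpace ℝ (Idx nn)) :
    ⟪matCLM P.R x, y⟫ = ⟪x, matCLM P.R y⟫ := by
  rw [inner_matCLM_left, R, blockDiagonal'_transpose]
  congr 4
  funext i
  simpa using (hP.R_psd i).isHermitian.eq

lemma R_nonneg (hP : P.Assumption T x₀ u) (x : EuclideanSpace ℝ (Idx nn)) : 0 ≤ ⟪matCLM P.R x, x⟫ :=
  blockDiagonal'_inner_nonneg hP.R_psd x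

lemma transpose_Jd (hP : P.Assumption T x₀ u) : P.Jdᵀ = -P.Jd := by
  rw [Jd, blockDiagonal'_transpose, ← blockDiagonal'_neg]
  congr 1
  funext i
  exact hP.J_skew i

lemma transpose_J (hP : P.Assumption T x₀ u) : P.Jᵀ = -P.J := by
  rw [J, transpose_add, hP.transpose_Jd, P.transpose_Jo, neg_add]

lemma J_skew_inner (hP : P.Assumption T x₀ u) (x y : EuclideanSpace ℝ (Idx nn)) :
    ⟪matCLM P.J x, y⟫ = -⟪x, matCLM P.J y⟫ := by
  rw [inner_matCLM_left, hP.transpose_J, matCLM_neg, inner_neg_right]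

/-- By the symmetries of `E Q⁻¹`, `R` and `J`, such an `x` is orthogonal to all columns of `[E R
J]`, which has full row rank. -/
lemma kernel_trivial (hP : P.Assumption T x₀ u) (x : EuclideanSpace ℝ (Idx nn))
    (hE : matCLM (P.E * P.Q⁻¹) x = 0) (hR : matCLM P.R x = 0) (hJ : matCLM P.J x = 0) : x = 0 := by
  have hEt : P.Eᵀ *ᵥ x.ofLp = 0 := by
    have : matCLM P.Eᵀ x = 0 := by
      rw [← hP.E_mul_inv_mul, transpose_mul, hP.transpose_energy, matCLM_mul, hE, map_zero]
    exact congrArg WithLp.ofLp this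
  have hRt : P.Rᵀ *ᵥ x.ofLp = 0 := by
    have : matCLM P.Rᵀ x = 0 := ext_inner_left ℝ fun z => by
      rw [← inner_matCLM_left, hP.R_symm, hR]
    exact congrArg WithLp.ofLp this
  have hJt : P.Jᵀ *ᵥ x.ofLp = 0 := by
    have : matCLM P.Jᵀ x = 0 := by rw [hP.transpose_J, matCLM_neg, hJ, neg_zero]
    exact congrArg WithLp.ofLp this
  set M := Matrix.fromCols P.E (Matrix.fromCols P.R P.J) with hM
  have hx : Mᵀ.mulVecLin x.ofLp = 0 := by
    rw [mulVecLin_apply, mulVec_transpose, hM, vecMul_fromCols, vecMul_fromCols,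
      ← mulVec_transpose, ← mulVec_transpose, ← mulVec_transpose, hEt, hRt, hJt]
    ext i
    rcases i with i | i | i <;> rfl
  have hrank : Module.finrank ℝ (LinearMap.range Mᵀ.mulVecLin) = ∑ i, nn i := by
    have := hP.rank_ERJ
    rwa [← rank_transpose] at this
  have hker : LinearMap.ker Mᵀ.mulVecLin = ⊥ := by
    have h1 := LinearMap.finrank_range_add_finrank_ker Mᵀ.mulVecLin
    rw [hrank, Module.finrank_fintype_fun_eq_card, Fintype.card_sigma] at h1
    simp only [Fintype.card_fin] at h1
    exact Submodule.finrank_eq_zero.1 (by omega)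
  have : x.ofLp = 0 := LinearMap.ker_eq_bot'.1 hker _ hx
  exact WithLp.ofLp_injective 2 this

end Assumption

end PHBlocks

namespace PHBlocks

open scoped RealInnerProductSpace
open scoped Matrix

variable {s m : ℕ} {nn : Fin s → ℕ} {P : PHBlocks s nn m} {T : ℝ}
  {x₀ : EuclideanSpace ℝ (Idx nn)} {u : L2 T (Fin m)}

/-! ### The domain of `M` -/

lemma isPrim_of_mem_domM (hT : 0 < T) {x : L2 T (Idx nn)} (hx : x ∈ P.domM x₀) :
    IsPrim T (matCLM P.E x₀) (weakDeriv (matL2 T P.E x)) (matL2 T P.E x) := by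
  obtain ⟨h1, Y, hY, hY0⟩ := hx
  rw [← hY0]
  exact h1.exists_isPrim hT hY

lemma mem_domM_of_isPrim (hT : 0 < T) {x d : L2 T (Idx nn)}
    (h : IsPrim T (matCLM P.E x₀) d (matL2 T P.E x)) :
    x ∈ P.domM x₀ ∧ weakDeriv (matL2 T P.E x) = d := by
  obtain ⟨h1, h2⟩ := weakDeriv_eq_of_isPrim hT h
  exact ⟨⟨h1, _, h.isContRep hT, by simp⟩, h2⟩

namespace Assumption

lemma matL2_Q_inv_Q (hP : P.Assumption T x₀ u) (x : L2 T (Idx nn)) :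
    matL2 T P.Q⁻¹ (matL2 T P.Q x) = x := by
  rw [← matL2_mul, hP.Q_inv_mul, matL2_one]

lemma matL2_Q_Q_inv (hP : P.Assumption T x₀ u) (x : L2 T (Idx nn)) :
    matL2 T P.Q (matL2 T P.Q⁻¹ x) = x := by
  rw [← matL2_mul, hP.Q_mul_inv, matL2_one]

lemma mem_domMQ_iff (hP : P.Assumption T x₀ u) {v : L2 T (Idx nn)} :
    v ∈ P.domMQ x₀ ↔ matL2 T P.Q⁻¹ v ∈ P.domM x₀ := by
  constructor
  · rintro ⟨x, hx, rfl⟩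
    rwa [hP.matL2_Q_inv_Q]
  · intro h
    exact ⟨_, h, hP.matL2_Q_Q_inv v⟩

lemma matL2_E_inv (v : L2 T (Idx nn)) :
    matL2 T P.E (matL2 T P.Q⁻¹ v) = matL2 T (P.E * P.Q⁻¹) v := (matL2_mul _ _ _).symm

lemma isPrim_energy (hP : P.Assumption T x₀ u) {v : L2 T (Idx nn)} (hv : v ∈ P.domMQ x₀) :
    IsPrim T (matCLM P.E x₀) (weakDeriv (matL2 T (P.E * P.Q⁻¹) v))
      (matL2 T (P.E * P.Q⁻¹) v) := by
  have := isPrim_of_mem_domM hP.T_pos (hP.mem_domMQ_iff.1 hv)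
  rwa [matL2_E_inv] at this

/-- Functions `y` with `d/dt S y = d`, `S y(0) = E x₀`, where `S = E Q⁻¹`, define elements of the
domain of `M Q⁻¹`. -/
lemma exists_mem_domMQ (hP : P.Assumption T x₀ u) {A : Matrix (Idx nn) (Idx nn) ℝ}
    {g : L2 T (Idx nn)} {y : ℝ → EuclideanSpace ℝ (Idx nn)} (hy : MemLp y 2 (timeMeasure T))
    (h : IsPrim T (matCLM (P.E * P.Q⁻¹) (matCLM P.Q x₀)) (fun t => matCLM A (y t) + g t)
      (fun t => matCLM (P.E * P.Q⁻¹) (y t))) :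
    ∃ v ∈ P.domMQ x₀, weakDeriv (matL2 T (P.E * P.Q⁻¹) v) = matL2 T A v + g := by
  rw [← matCLM_mul, hP.E_mul_inv_mul] at h
  have h1 : IsPrim T (matCLM P.E x₀) (matL2 T A (hy.toLp y) + g : L2 T (Idx nn))
      (matL2 T P.E (matL2 T P.Q⁻¹ (hy.toLp y))) := by
    rw [matL2_E_inv]
    refine h.congr ?_ ?_
    · filter_upwards [Lp.coeFn_add (matL2 T A (hy.toLp y)) g, matL2_ae A (hy.toLp y),
        hy.coeFn_toLp] with t h1 h2 h3
      rw [h1, Pi.add_apply, h2, h3]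
    · filter_upwards [matL2_ae (P.E * P.Q⁻¹) (hy.toLp y), hy.coeFn_toLp] with t h2 h3
      rw [h2, h3]
  obtain ⟨h2, h3⟩ := mem_domM_of_isPrim hP.T_pos h1
  rw [matL2_E_inv] at h3
  exact ⟨hy.toLp y, hP.mem_domMQ_iff.2 h2, h3⟩

variable {α μ lam : ℝ}

lemma opM_inv (hP : P.Assumption T x₀ u) (v : L2 T (Idx nn)) :
    P.opM u α μ (matL2 T P.Q⁻¹ v) = weakDeriv (matL2 T (P.E * P.Q⁻¹) v)
      - matL2 T (P.Jd - α • P.R + μ • (P.E * P.Q⁻¹)) v - matL2 T P.B u := by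
  rw [opM, matL2_E_inv, matL2_mul _ P.Q, hP.matL2_Q_Q_inv]

lemma opN_inv (hP : P.Assumption T x₀ u) (v : L2 T (Idx nn)) :
    P.opN α μ (matL2 T P.Q⁻¹ v) = matL2 T ((1 - α) • P.R + μ • (P.E * P.Q⁻¹) - P.Jo) v := by
  rw [opN, matL2_mul _ P.Q, hP.matL2_Q_Q_inv]

lemma inner_M_part (hP : P.Assumption T x₀ u) (α μ : ℝ) (x : EuclideanSpace ℝ (Idx nn)) :
    ⟪matCLM (P.Jd - α • P.R + μ • (P.E * P.Q⁻¹)) x, x⟫ =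
      -(α * ⟪matCLM P.R x, x⟫) + μ * ⟪matCLM (P.E * P.Q⁻¹) x, x⟫ := by
  simp only [matCLM_add, matCLM_sub, matCLM_smul, add_apply, sub_apply, smul_apply,
    inner_add_left, inner_sub_left, real_inner_smul_left,
    inner_matCLM_self_of_skew hP.transpose_Jd]
  ring

lemma inner_N_nonneg (hP : P.Assumption T x₀ u) (hα : α ≤ 1) (hμ : 0 ≤ μ)
    (x : EuclideanSpace ℝ (Idx nn)) :
    0 ≤ ⟪matCLM ((1 - α) • P.R + μ • (P.E * P.Q⁻¹) - P.Jo) x, x⟫ := by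
  simp only [matCLM_add, matCLM_sub, matCLM_smul, add_apply, sub_apply, smul_apply,
    inner_add_left, inner_sub_left, real_inner_smul_left, inner_matCLM_self_of_skew P.transpose_Jo]
  have h1 := mul_nonneg (sub_nonneg.2 hα) (hP.R_nonneg x)
  have h2 := mul_nonneg hμ (hP.energy_nonneg x)
  linarith

/-- The energy balance for the difference of two elements of the domain of `M Q⁻¹`. -/
lemma exists_energy_sub (hP : P.Assumption T x₀ u) {v₁ v₂ : L2 T (Idx nn)}
    (h₁ : v₁ ∈ P.domMQ x₀) (h₂ : v₂ ∈ P.domMQ x₀) :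
    ∃ q : ℝ → ℝ, (∀ t ∈ Icc 0 T, 0 ≤ q t) ∧
      (∀ t ∈ Icc 0 T, ‖(∫ r in (0 : ℝ)..t, weakDeriv (matL2 T (P.E * P.Q⁻¹) v₁) r) -
        ∫ r in (0 : ℝ)..t, weakDeriv (matL2 T (P.E * P.Q⁻¹) v₂) r‖ ^ 2 ≤
          (‖matCLM (P.E * P.Q⁻¹)‖ + 1) * q t) ∧
      ∀ ω, ∀ t ∈ Icc 0 T, wint ω t (fun r => ⟪(weakDeriv (matL2 T (P.E * P.Q⁻¹) v₁) -
          weakDeriv (matL2 T (P.E * P.Q⁻¹) v₂)) r, (v₁ - v₂) r⟫) =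
        1 / 2 * (Real.exp (-2 * t * ω) * q t) +
          ω * wint ω t (fun r => ⟪matCLM (P.E * P.Q⁻¹) ((v₁ - v₂) r), (v₁ - v₂) r⟫) := by
  set d₁ := weakDeriv (matL2 T (P.E * P.Q⁻¹) v₁)
  set d₂ := weakDeriv (matL2 T (P.E * P.Q⁻¹) v₂)
  have hsub := (hP.isPrim_energy h₁).sub (hP.isPrim_energy h₂) (L2.integrable d₁)
    (L2.integrable d₂)
  rw [sub_self] at hsub
  have hprim : IsPrim T 0 (d₁ - d₂ : L2 T (Idx nn))
      (fun t => matCLM (P.E * P.Q⁻¹) ((v₁ - v₂) t)) := by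
    refine hsub.congr (Lp.coeFn_sub d₁ d₂).symm ?_
    filter_upwards [matL2_ae (P.E * P.Q⁻¹) v₁, matL2_ae (P.E * P.Q⁻¹) v₂,
      Lp.coeFn_sub v₁ v₂] with t e1 e2 e3
    rw [e1, e2, e3, Pi.sub_apply, map_sub]
  obtain ⟨q, hq1, hq2⟩ := exists_energy hP.T_pos hP.energy_symm hP.energy_nonneg
    (Lp.memLp (d₁ - d₂)) (Lp.memLp (v₁ - v₂)) hprim
  refine ⟨q, fun t ht => ?_, fun t ht => ?_, hq2⟩
  · exact nonneg_of_mul_nonneg_right ((sq_nonneg _).trans (hq1 t ht)) (by positivity)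
  · rw [← intervalIntegral.integral_sub (intervalIntegrable_of_timeMeasure (L2.integrable d₁) ht)
      (intervalIntegrable_of_timeMeasure (L2.integrable d₂) ht)]
    have := hq1 t ht
    rwa [integral_congr_of_timeMeasure (Lp.coeFn_sub d₁ d₂) ht] at this

lemma integrable_inner_matCLM (A : Matrix (Idx nn) (Idx nn) ℝ) (a : L2 T (Idx nn)) :
    Integrable (fun r => ⟪matCLM A (a r), a r⟫) (timeMeasure T) :=
  MemLp.integrable_real_inner (MemLp.clm _ (Lp.memLp a)) (Lp.memLp a)

/-- The energy balance for `M Q⁻¹`. -/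
lemma exists_energy_opM (hP : P.Assumption T x₀ u) (α μ : ℝ) {v₁ v₂ : L2 T (Idx nn)}
    (h₁ : v₁ ∈ P.domMQ x₀) (h₂ : v₂ ∈ P.domMQ x₀) :
    ∃ q : ℝ → ℝ, (∀ t ∈ Icc 0 T, 0 ≤ q t) ∧
      (∀ t ∈ Icc 0 T, ‖(∫ r in (0 : ℝ)..t, weakDeriv (matL2 T (P.E * P.Q⁻¹) v₁) r) -
        ∫ r in (0 : ℝ)..t, weakDeriv (matL2 T (P.E * P.Q⁻¹) v₂) r‖ ^ 2 ≤
          (‖matCLM (P.E * P.Q⁻¹)‖ + 1) * q t) ∧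
      ∀ ω, ∀ t ∈ Icc 0 T, wint ω t (fun r => ⟪(v₁ - v₂) r,
          (P.opM u α μ (matL2 T P.Q⁻¹ v₁) - P.opM u α μ (matL2 T P.Q⁻¹ v₂)) r⟫) =
        1 / 2 * (Real.exp (-2 * t * ω) * q t) +
          ((ω - μ) * wint ω t (fun r => ⟪matCLM (P.E * P.Q⁻¹) ((v₁ - v₂) r), (v₁ - v₂) r⟫) +
          α * wint ω t (fun r => ⟪matCLM P.R ((v₁ - v₂) r), (v₁ - v₂) r⟫)) := by
  obtain ⟨q, hq0, hq1, hq2⟩ := hP.exists_energy_sub h₁ h₂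
  refine ⟨q, hq0, hq1, fun ω t ht => ?_⟩
  set d₁ := weakDeriv (matL2 T (P.E * P.Q⁻¹) v₁) with hd₁
  set d₂ := weakDeriv (matL2 T (P.E * P.Q⁻¹) v₂) with hd₂
  set G := P.Jd - α • P.R + μ • (P.E * P.Q⁻¹) with hG
  have hb : P.opM u α μ (matL2 T P.Q⁻¹ v₁) - P.opM u α μ (matL2 T P.Q⁻¹ v₂) =
      (d₁ - d₂) - matL2 T G (v₁ - v₂) := by
    rw [hP.opM_inv, hP.opM_inv, map_sub]
    abel
  set a := v₁ - v₂
  set d := d₁ - d₂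
  have hae : (fun r => ⟪a r, (P.opM u α μ (matL2 T P.Q⁻¹ v₁) -
      P.opM u α μ (matL2 T P.Q⁻¹ v₂)) r⟫) =ᵐ[timeMeasure T]
      fun r => ⟪d r, a r⟫ + ((-μ) * ⟪matCLM (P.E * P.Q⁻¹) (a r), a r⟫ +
        α * ⟪matCLM P.R (a r), a r⟫) := by
    rw [hb]
    filter_upwards [Lp.coeFn_sub d (matL2 T G a), matL2_ae G a] with r e1 e2
    rw [e1, Pi.sub_apply, e2, inner_sub_right, real_inner_comm (d r),
      real_inner_comm (matCLM G (a r)), hG, hP.inner_M_part]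
    ring
  have i0 : Integrable (fun r => ⟪d r, a r⟫) (timeMeasure T) := L2.integrable_inner d a
  have i1 := (integrable_inner_matCLM (P.E * P.Q⁻¹) a).const_mul (-μ)
  have i2 := (integrable_inner_matCLM P.R a).const_mul α
  have i3 : Integrable (fun r => (-μ) * ⟪matCLM (P.E * P.Q⁻¹) (a r), a r⟫ +
      α * ⟪matCLM P.R (a r), a r⟫) (timeMeasure T) := i1.add i2
  rw [wint_congr hae ω ht, wint_add i0 i3 ω ht, hq2 ω t ht, wint_add i1 i2 ω ht,
    wint_const_mul, wint_const_mul]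
  ring

/-- The exponential weight contributes `ω⟨S a, a⟩`, which compensates the term `-μ S` in `M Q⁻¹` as
soon as `ω ≥ μ`. -/
lemma wint_opM_nonneg (hP : P.Assumption T x₀ u) (hα : 0 ≤ α) {v₁ v₂ : L2 T (Idx nn)}
    (h₁ : v₁ ∈ P.domMQ x₀) (h₂ : v₂ ∈ P.domMQ x₀) {ω : ℝ} (hω : μ ≤ ω) {t : ℝ}
    (ht : t ∈ Icc 0 T) :
    0 ≤ wint ω t (fun r => ⟪(v₁ - v₂) r,
      (P.opM u α μ (matL2 T P.Q⁻¹ v₁) - P.opM u α μ (matL2 T P.Q⁻¹ v₂)) r⟫) := by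
  obtain ⟨q, hq0, -, hq⟩ := hP.exists_energy_opM α μ h₁ h₂
  rw [hq ω t ht]
  have h1 := hq0 t ht
  have h2 := sub_nonneg.2 hω
  have h3 := wint_nonneg (fun r => hP.energy_nonneg ((v₁ - v₂) r)) ω ht.1
  have h4 := wint_nonneg (fun r => hP.R_nonneg ((v₁ - v₂) r)) ω ht.1
  positivity

/-! ### The resolvents -/

lemma shiftM_sub (v₁ v₂ : L2 T (Idx nn)) (c : ℝ) :
    P.shiftM u α μ c v₁ - P.shiftM u α μ c v₂ = (v₁ - v₂) +
      c • (P.opM u α μ (matL2 T P.Q⁻¹ v₁) - P.opM u α μ (matL2 T P.Q⁻¹ v₂)) := by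
  simp only [shiftM, smul_sub]
  abel

lemma shiftN_sub (hP : P.Assumption T x₀ u) (v₁ v₂ : L2 T (Idx nn)) (c : ℝ) :
    P.shiftN α μ c v₁ - P.shiftN α μ c v₂ = (v₁ - v₂) +
      c • matL2 T ((1 - α) • P.R + μ • (P.E * P.Q⁻¹) - P.Jo) (v₁ - v₂) := by
  simp only [shiftN, hP.opN_inv, map_sub, smul_sub]
  abel

lemma coeFn_add_smul {κ : Type} [Fintype κ] (a b : L2 T κ) (c : ℝ) :
    ∀ᵐ t ∂timeMeasure T, (a + c • b) t = a t + c • b t := by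
  filter_upwards [Lp.coeFn_add a (c • b), Lp.coeFn_smul c b] with t e1 e2
  rw [e1, Pi.add_apply, e2, Pi.smul_apply]

/-- Injectivity is monotonicity with weight `μ`. For surjectivity, the resolvent equation is
rewritten as `d/dt S v = (G - λ⁻¹) v + B u + λ⁻¹ f`. -/
lemma bijOn_shiftM (hP : P.Assumption T x₀ u) (hlam : 0 < lam) (hμ : 0 ≤ μ) (hα : 0 ≤ α) :
    Set.BijOn (P.shiftM u α μ lam) (P.domMQ x₀) Set.univ := by
  refine ⟨fun _ _ => mem_univ _, fun v₁ h₁ v₂ h₂ heq => ?_, fun f _ => ?_⟩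
  · have hTT : T ∈ Icc 0 T := ⟨hP.T_pos.le, le_rfl⟩
    have h0 := shiftM_sub (P := P) (u := u) (α := α) (μ := μ) v₁ v₂ lam
    rw [heq, sub_self] at h0
    have hle := wint_norm_sq_le (Lp.memLp (v₁ - v₂)) (Lp.memLp (P.opM u α μ (matL2 T P.Q⁻¹ v₁) -
      P.opM u α μ (matL2 T P.Q⁻¹ v₂))) hlam.le μ hTT (hP.wint_opM_nonneg hα h₁ h₂ le_rfl hTT)
    have hz : wint μ T (fun r => ‖(v₁ - v₂) r + lam • (P.opM u α μ (matL2 T P.Q⁻¹ v₁) -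
        P.opM u α μ (matL2 T P.Q⁻¹ v₂)) r‖ ^ 2) = wint μ T (fun _ => 0) := by
      refine wint_congr ?_ μ hTT
      filter_upwards [coeFn_add_smul (v₁ - v₂) (P.opM u α μ (matL2 T P.Q⁻¹ v₁) -
        P.opM u α μ (matL2 T P.Q⁻¹ v₂)) lam, Lp.coeFn_zero (EuclideanSpace ℝ (Idx nn)) 2
          (timeMeasure T)] with r e1 e2
      rw [← e1, ← h0, e2]
      simp
    rw [hz, show wint μ T (fun _ => (0 : ℝ)) = 0 by simp [wint]] at hle
    have hae := ae_eq_zero_of_wint_nonpos hP.T_pos.le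
      (MemLp.integrable_norm_sq (Lp.memLp (v₁ - v₂))) (fun _ => sq_nonneg _) hμ hle
    rw [← sub_eq_zero]
    refine Lp.ext ?_
    filter_upwards [hae, Lp.coeFn_zero (EuclideanSpace ℝ (Idx nn)) 2 (timeMeasure T)]
      with r e1 e2
    rw [e2]
    simpa using e1
  · set G := P.Jd - α • P.R + μ • (P.E * P.Q⁻¹) with hG
    set g : L2 T (Idx nn) := matL2 T P.B u + lam⁻¹ • f with hg
    -- The pencil parameter `μ` cancels the term `μ S` of `G`, leaving the symmetric part `α R +
    -- λ⁻¹`.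
    have hpos : ∀ x, x ≠ 0 → 0 < ⟪μ • matCLM (P.E * P.Q⁻¹) x - matCLM (G - lam⁻¹ • 1) x, x⟫ := by
      intro x hx
      rw [matCLM_sub, matCLM_smul, sub_apply, smul_apply, matCLM_one, inner_sub_left,
        inner_sub_left, real_inner_smul_left, real_inner_smul_left, hG, hP.inner_M_part,
        real_inner_self_eq_norm_sq]
      have h1 := mul_nonneg hα (hP.R_nonneg x)
      have h2 : 0 < lam⁻¹ * ‖x‖ ^ 2 := by have := norm_pos_iff.2 hx; positivity
      linarith
    obtain ⟨y, hy, hprim⟩ := exists_dae_solution_of_pos hP.T_pos hP.energy_symm hpos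
      (Lp.memLp g) (matCLM P.Q x₀)
    obtain ⟨v, hv, hd⟩ := hP.exists_mem_domMQ hy hprim
    refine ⟨v, hv, ?_⟩
    rw [shiftM, hP.opM_inv, hd, ← hG, matL2_sub, matL2_smul, sub_apply, smul_apply, matL2_one, hg]
    have : lam • lam⁻¹ • v = v := smul_inv_smul₀ hlam.ne' v
    have h2 : lam • lam⁻¹ • f = f := smul_inv_smul₀ hlam.ne' f
    calc v + lam • (matL2 T G v - lam⁻¹ • v + (matL2 T P.B u + lam⁻¹ • f) - matL2 T G v -
          matL2 T P.B u) = v + (lam • lam⁻¹ • f - lam • lam⁻¹ • v) := by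
          rw [← smul_sub]; congr 2; abel
      _ = f := by rw [this, h2]; abel

lemma bijective_shiftN (hP : P.Assumption T x₀ u) (hlam : 0 < lam) (hμ : 0 ≤ μ) (hα : α ≤ 1) :
    Function.Bijective (P.shiftN (T := T) α μ lam) := by
  set N := (1 - α) • P.R + μ • (P.E * P.Q⁻¹) - P.Jo with hN
  have hsh : ∀ v, P.shiftN (T := T) α μ lam v = matL2 T (1 + lam • N) v := fun v => by
    rw [shiftN, hP.opN_inv, matL2_add, matL2_smul, add_apply, smul_apply, matL2_one]
  have hK : ∀ x, matCLM (1 + lam • N) x = 0 → x = 0 := fun x hx => by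
    have h1 : ⟪matCLM (1 + lam • N) x, x⟫ = ‖x‖ ^ 2 + lam * ⟪matCLM N x, x⟫ := by
      rw [matCLM_add, matCLM_smul, add_apply, smul_apply, matCLM_one, inner_add_left,
        real_inner_smul_left, real_inner_self_eq_norm_sq]
    rw [hx, inner_zero_left] at h1
    have h2 := mul_nonneg hlam.le (hP.inner_N_nonneg hα hμ x)
    have h3 : ‖x‖ ^ 2 = 0 := le_antisymm (by linarith) (sq_nonneg _)
    simpa using h3
  obtain ⟨K', hK1, hK2⟩ := exists_clm_inverse hK
  obtain ⟨A, rfl⟩ := exists_matCLM_eq K'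
  refine Function.bijective_iff_has_inverse.2 ⟨matL2 T A, fun v => ?_, fun v => ?_⟩
  · rw [hsh]
    refine Lp.ext ?_
    filter_upwards [matL2_ae A (matL2 T (1 + lam • N) v), matL2_ae (1 + lam • N) v] with t e1 e2
    rw [e1, e2, hK2]
  · rw [hsh]
    refine Lp.ext ?_
    filter_upwards [matL2_ae (1 + lam • N) (matL2 T A v), matL2_ae A v] with t e1 e2
    rw [e1, e2, hK1]

end Assumption

end PHBlocks

namespace PHBlocks

open scoped RealInnerProductSpace
open scoped Matrix

variable {s m : ℕ} {nn : Fin s → ℕ} {P : PHBlocks s nn m} {T : ℝ}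
  {x₀ : EuclideanSpace ℝ (Idx nn)} {u : L2 T (Fin m)}

namespace Assumption

/-! ### Existence and uniqueness of solutions -/

/-- A matrix whose transpose maps into the range of `V` factors through `Vᵀ`. -/
lemma _root_.exists_eq_mul_transpose {ι κ τ : Type} [Fintype ι] [Fintype κ] [DecidableEq κ]
    [Fintype τ] {A : Matrix κ ι ℝ} {V : Matrix ι τ ℝ}
    (h : ∀ z : κ → ℝ, ∃ c, Aᵀ *ᵥ z = V *ᵥ c) : ∃ X : Matrix κ τ ℝ, A = X * Vᵀ := by
  choose c hc using fun j => h (Pi.single j 1)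
  refine ⟨Matrix.of c, Matrix.ext fun j i => ?_⟩
  have := congrFun (hc j) i
  rw [Matrix.mulVec_single_one] at this
  rw [Matrix.mul_apply]
  simpa [Matrix.mulVec, dotProduct, mul_comm] using this

/-- `hE` puts `Q⁻¹ v` in `ker E`, so `v = Q Z b`. Since `(Q Z)ᵀ S = (E Z)ᵀ = 0`, multiplying `hJ` by
`(Q Z)ᵀ` yields the second kernel condition on `b`. -/
lemma mem_range_hidden (hP : P.Assumption T x₀ u) {r r₁ : ℕ} {Z : Matrix (Idx nn) (Fin r) ℝ}
    {Z₁ : Matrix (Fin r) (Fin r₁) ℝ}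
    (hZ : LinearMap.range Z.mulVecLin = LinearMap.ker P.E.mulVecLin)
    (hZ₁ : LinearMap.range Z₁.mulVecLin = LinearMap.ker (P.R * P.Q * Z).mulVecLin ⊓
      LinearMap.ker (Z.transpose * P.Q.transpose * P.J * P.Q * Z).mulVecLin)
    {v w : EuclideanSpace ℝ (Idx nn)} (hE : matCLM (P.E * P.Q⁻¹) v = 0) (hR : matCLM P.R v = 0)
    (hJ : matCLM P.J v = matCLM (P.E * P.Q⁻¹) w) : ∃ c, v.ofLp = (P.Q * Z * Z₁) *ᵥ c := by
  have hE' : P.E *ᵥ (P.Q⁻¹ *ᵥ v.ofLp) = 0 := by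
    rw [Matrix.mulVec_mulVec]
    exact congrArg WithLp.ofLp hE
  have h1 : P.Q⁻¹ *ᵥ v.ofLp ∈ LinearMap.range Z.mulVecLin := by
    rw [hZ]
    exact hE'
  obtain ⟨b, hb⟩ := h1
  rw [Matrix.mulVecLin_apply] at hb
  have hv : v.ofLp = (P.Q * Z) *ᵥ b := by
    rw [← Matrix.mulVec_mulVec, hb, Matrix.mulVec_mulVec, hP.Q_mul_inv, Matrix.one_mulVec]
  have hEZ : P.E * Z = 0 := Matrix.ext_of_mulVec_single fun i => by
    have : Z *ᵥ Pi.single i 1 ∈ LinearMap.ker P.E.mulVecLin := by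
      rw [← hZ]
      exact ⟨_, rfl⟩
    rw [← Matrix.mulVec_mulVec, Matrix.zero_mulVec]
    exact this
  have hZS : Zᵀ * P.Qᵀ * (P.E * P.Q⁻¹) = 0 := by
    have : (P.E * P.Q⁻¹ * P.Q * Z)ᵀ = 0 := by rw [hP.E_mul_inv_mul, hEZ, Matrix.transpose_zero]
    rwa [Matrix.transpose_mul, Matrix.transpose_mul, hP.transpose_energy,
      ← Matrix.mul_assoc] at this
  have h2 : b ∈ LinearMap.range Z₁.mulVecLin := by
    rw [hZ₁]
    refine ⟨?_, ?_⟩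
    · change (P.R * P.Q * Z) *ᵥ b = 0
      rw [Matrix.mul_assoc, ← Matrix.mulVec_mulVec, ← hv]
      exact congrArg WithLp.ofLp hR
    · change (Zᵀ * P.Qᵀ * P.J * P.Q * Z) *ᵥ b = 0
      have e : P.J *ᵥ v.ofLp = (P.E * P.Q⁻¹) *ᵥ w.ofLp := congrArg WithLp.ofLp hJ
      rw [Matrix.mul_assoc _ P.Q, ← Matrix.mulVec_mulVec, ← hv, ← Matrix.mulVec_mulVec, e,
        Matrix.mulVec_mulVec, hZS, Matrix.zero_mulVec]
  obtain ⟨c, hc⟩ := h2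
  refine ⟨c, ?_⟩
  rw [hv, ← hc, Matrix.mulVecLin_apply, Matrix.mulVec_mulVec]

/-- Every `L` in the abstract constraint factors as `X (Q Z Z₁)ᵀ` by `mem_range_hidden`, so `L B u`
inherits its derivative, and its initial value, from the consistency assumption. -/
lemma exists_solution (hP : P.Assumption T x₀ u) : ∃ x, P.IsSolution x₀ u x := by
  obtain ⟨r, r₁, Z, Z₁, -, -, hZ, hZ₁, hH1, Y, hY, hY0⟩ := hP.consistent
  have hprim := hH1.exists_isPrim hP.T_pos hY
  have hVt : Z₁ᵀ * Zᵀ * P.Qᵀ = (P.Q * Z * Z₁)ᵀ := by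
    rw [Matrix.transpose_mul, Matrix.transpose_mul, ← Matrix.mul_assoc]
  obtain ⟨y, hy, hsol⟩ := exists_port_hamiltonian_solution hP.T_pos hP.energy_symm hP.energy_nonneg
    hP.R_symm hP.R_nonneg hP.J_skew_inner hP.kernel_trivial (Lp.memLp (matL2 T P.B u))
    (matCLM P.Q x₀) fun L hL => by
      obtain ⟨A, rfl⟩ := exists_matCLM_eq L
      have hadj : ∀ z, ContinuousLinearMap.adjoint (matCLM A) z = matCLM Aᵀ z := fun z =>
        ext_inner_right ℝ fun x => by
          rw [ContinuousLinearMap.adjoint_inner_left, real_inner_comm, inner_matCLM_left,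
            real_inner_comm]
      obtain ⟨X, hX⟩ := exists_eq_mul_transpose (A := A) (V := P.Q * Z * Z₁) fun z => by
        obtain ⟨h1, h2, w, h3⟩ := hL (WithLp.toLp 2 z)
        rw [hadj] at h1 h2 h3
        exact hP.mem_range_hidden hZ hZ₁ h1 h2 h3
      rw [← hVt] at hX
      refine ⟨fun t => matCLM X (weakDeriv (matL2 T (Z₁ᵀ * Zᵀ * P.Qᵀ * P.B) u) t),
        MemLp.clm _ (Lp.memLp _), ?_⟩
      have h1 := hprim.map (L2.integrable _) (matCLM X)
      have hc : -matCLM A (matCLM P.J (matCLM P.Q x₀)) = matCLM X (Y 0) := by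
        rw [hX, matCLM_mul, ← matCLM_mul P.J, ← matCLM_mul (_ * P.Qᵀ), ← Matrix.mul_assoc,
          eq_neg_of_add_eq_zero_left hY0, map_neg, neg_neg]
      rw [hc]
      refine h1.congr EventuallyEq.rfl ?_
      filter_upwards [matL2_ae (Z₁ᵀ * Zᵀ * P.Qᵀ * P.B) u, matL2_ae P.B u] with t e1 e2
      rw [e1, e2, hX, matCLM_mul X, matCLM_mul (_ * P.Qᵀ)]
  rw [← matCLM_sub] at hsol
  obtain ⟨v, hv, hd⟩ := hP.exists_mem_domMQ hy hsol
  refine ⟨matL2 T P.Q⁻¹ v, hP.mem_domMQ_iff.1 hv, ?_⟩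
  rw [matL2_E_inv, hd, matL2_mul, hP.matL2_Q_Q_inv]

lemma solution_mem_domMQ {x : L2 T (Idx nn)} (h : P.IsSolution x₀ u x) :
    matL2 T P.Q x ∈ P.domMQ x₀ := ⟨x, h.1, rfl⟩

lemma weakDeriv_solution (hP : P.Assumption T x₀ u) {x : L2 T (Idx nn)}
    (h : P.IsSolution x₀ u x) : weakDeriv (matL2 T (P.E * P.Q⁻¹) (matL2 T P.Q x)) =
      matL2 T (P.J - P.R) (matL2 T P.Q x) + matL2 T P.B u := by
  rw [← matL2_mul, hP.E_mul_inv_mul, h.2, matL2_mul]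

/-- In the energy balance of the difference `a`, all terms have one sign, which forces `S a = 0` and
`R a = 0`. Then `0 = d/dt S a = (J - R) a` gives `J a = 0`, and `kernel_trivial` applies. -/
lemma solution_unique (hP : P.Assumption T x₀ u) {x₁ x₂ : L2 T (Idx nn)}
    (h₁ : P.IsSolution x₀ u x₁) (h₂ : P.IsSolution x₀ u x₂) : x₁ = x₂ := by
  have hT := hP.T_pos
  have hTT : T ∈ Icc 0 T := ⟨hT.le, le_rfl⟩
  set v₁ := matL2 T P.Q x₁ with hv₁
  set v₂ := matL2 T P.Q x₂ with hv₂
  obtain ⟨q, hq0, -, hq⟩ := hP.exists_energy_sub (solution_mem_domMQ h₁) (solution_mem_domMQ h₂)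
  -- A positive weight is needed to keep the integral of `⟨S a, a⟩` in the balance.
  have hq := hq 1 T hTT
  have hprim := (hP.isPrim_energy (solution_mem_domMQ h₁)).sub
    (hP.isPrim_energy (solution_mem_domMQ h₂)) (L2.integrable _) (L2.integrable _)
  rw [hP.weakDeriv_solution h₁, hP.weakDeriv_solution h₂] at hq hprim
  rw [← hv₁, ← hv₂] at hq hprim
  set g₁ : L2 T (Idx nn) := matL2 T (P.J - P.R) v₁ + matL2 T P.B u with hg₁
  set g₂ : L2 T (Idx nn) := matL2 T (P.J - P.R) v₂ + matL2 T P.B u with hg₂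
  set a := v₁ - v₂ with ha
  have hg : g₁ - g₂ = matL2 T (P.J - P.R) a := by
    rw [ha, map_sub, hg₁, hg₂]; abel
  have iR := integrable_inner_matCLM P.R a
  have iE := integrable_inner_matCLM (P.E * P.Q⁻¹) a
  have hae : (fun r => ⟪(g₁ - g₂) r, a r⟫) =ᵐ[timeMeasure T]
      fun r => (-1) * ⟪matCLM P.R (a r), a r⟫ := by
    rw [hg]
    filter_upwards [matL2_ae (P.J - P.R) a] with r e
    rw [e, matCLM_sub, sub_apply, inner_sub_left, inner_matCLM_self_of_skew hP.transpose_J]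
    ring
  rw [wint_congr hae 1 hTT, wint_const_mul] at hq
  have n1 := wint_nonneg (fun r => hP.energy_nonneg (a r)) 1 hT.le
  have n2 := wint_nonneg (fun r => hP.R_nonneg (a r)) 1 hT.le
  have n3 := mul_nonneg (Real.exp_pos (-2 * T * 1)).le (hq0 T hTT)
  have zE := ae_eq_zero_of_wint_nonpos hT.le iE (fun r => hP.energy_nonneg (a r)) zero_le_one
    (by linarith)
  have zR := ae_eq_zero_of_wint_nonpos hT.le iR (fun r => hP.R_nonneg (a r)) zero_le_one
    (by linarith)
  have hE0 : ∀ᵐ r ∂timeMeasure T, matCLM (P.E * P.Q⁻¹) (a r) = 0 := by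
    filter_upwards [zE] with r h
    exact eq_zero_of_inner_nonpos hP.energy_symm hP.energy_nonneg h.le
  have hR0 : ∀ᵐ r ∂timeMeasure T, matCLM P.R (a r) = 0 := by
    filter_upwards [zR] with r h
    exact eq_zero_of_inner_nonpos hP.R_symm hP.R_nonneg h.le
  have hd0 : ∀ᵐ r ∂timeMeasure T, g₁ r - g₂ r = 0 := by
    have h0 : IsPrim T (0 : EuclideanSpace ℝ (Idx nn)) (fun _ => 0)
        (fun t => matL2 T (P.E * P.Q⁻¹) v₁ t - matL2 T (P.E * P.Q⁻¹) v₂ t) := by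
      filter_upwards [hE0, matL2_ae (P.E * P.Q⁻¹) v₁, matL2_ae (P.E * P.Q⁻¹) v₂,
        Lp.coeFn_sub v₁ v₂] with t e1 e2 e3 e4
      rw [e2, e3, ← map_sub, ← Pi.sub_apply, ← e4, e1]
      simp
    exact (hprim.unique hT h0 ((L2.integrable g₁).sub (L2.integrable g₂))
      (integrable_zero _ _ _)).2
  have ha0 : a = 0 := by
    refine Lp.ext ?_
    filter_upwards [hE0, hR0, hd0, Lp.coeFn_sub g₁ g₂, matL2_ae (P.J - P.R) a,
      Lp.coeFn_zero (EuclideanSpace ℝ (Idx nn)) 2 (timeMeasure T)] with r e1 e2 e3 e4 e5 e6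
    rw [e6]
    refine hP.kernel_trivial _ e1 e2 ?_
    rw [Pi.sub_apply, e3, hg, e5, matCLM_sub, sub_apply, e2, sub_zero] at e4
    exact e4
  rw [← hP.matL2_Q_inv_Q x₁, ← hP.matL2_Q_inv_Q x₂, ← hv₁, ← hv₂, sub_eq_zero.1 ha0]

/-! ### The Lions–Mercier iteration -/

variable {α μ lam : ℝ}

lemma opM_add_opN_solution {x : L2 T (Idx nn)} (h : P.IsSolution x₀ u x) :
    P.opM u α μ x + P.opN α μ x = 0 := by
  have hm : P.J - P.R = (P.Jd - α • P.R + μ • (P.E * P.Q⁻¹)) -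
      ((1 - α) • P.R + μ • (P.E * P.Q⁻¹) - P.Jo) := by
    rw [J, sub_smul, one_smul]
    abel
  rw [opM, opN, h.2, hm, Matrix.sub_mul, matL2_sub, sub_apply]
  abel

/-- This frees the step from its inverses: by the two bijectivity results, `invFun` and `invFunOn`
are evaluated only where a preimage exists, so no default value enters. -/
lemma lionsMercierStep_spec (hP : P.Assumption T x₀ u) (hlam : 0 < lam) (hμ : 0 ≤ μ)
    (hα₀ : 0 ≤ α) (hα₁ : α ≤ 1) (x : L2 T (Idx nn)) :
    P.lionsMercierStep x₀ u α μ lam x ∈ P.domM x₀ ∧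
    ∃ r : L2 T (Idx nn), P.shiftN α μ lam r = P.shiftM u α μ (-lam) (matL2 T P.Q x) ∧
      P.shiftM u α μ lam (matL2 T P.Q (P.lionsMercierStep x₀ u α μ lam x)) =
        P.shiftN α μ (-lam) r := by
  have hN := (hP.bijective_shiftN hlam hμ hα₁).2
  have hM := (hP.bijOn_shiftM hlam hμ hα₀).surjOn
  set r := Function.invFun (P.shiftN α μ lam) (P.shiftM u α μ (-lam) (matL2 T P.Q x)) with hr
  have h := hM (mem_univ (P.shiftN α μ (-lam) r))
  refine ⟨hP.mem_domMQ_iff.1 (Function.invFunOn_mem h), r, Function.invFun_eq (hN _), ?_⟩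
  rw [lionsMercierStep, hP.matL2_Q_Q_inv]
  exact Function.invFunOn_eq h

lemma shiftM_neg_solution (hP : P.Assumption T x₀ u) {x : L2 T (Idx nn)}
    (h : P.IsSolution x₀ u x) (c : ℝ) :
    P.shiftM u α μ (-c) (matL2 T P.Q x) = P.shiftN α μ c (matL2 T P.Q x) := by
  rw [shiftM, shiftN, hP.matL2_Q_inv_Q, eq_neg_of_add_eq_zero_left (opM_add_opN_solution h),
    neg_smul, smul_neg, neg_neg]

/-- By `shiftM_neg_solution`, `v = Q x` is its own intermediate point `r`. Subtracting its relations
from those of the step cancels the affine terms and leaves the situation of `wint_norm_sq_step`. -/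
lemma wint_lionsMercierStep (hP : P.Assumption T x₀ u) (hlam : 0 < lam) (hμ : 0 ≤ μ)
    (hα₀ : 0 ≤ α) (hα₁ : α ≤ 1) {x : L2 T (Idx nn)} (hx : P.IsSolution x₀ u x)
    (y : L2 T (Idx nn)) (ω : ℝ) {t : ℝ} (ht : t ∈ Icc 0 T) :
    wint ω t (fun r => ‖(P.shiftM u α μ lam
        (matL2 T P.Q (P.lionsMercierStep x₀ u α μ lam y)) -
          P.shiftM u α μ lam (matL2 T P.Q x)) r‖ ^ 2) ≤
      wint ω t (fun r => ‖(P.shiftM u α μ lam (matL2 T P.Q y) -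
          P.shiftM u α μ lam (matL2 T P.Q x)) r‖ ^ 2) -
        4 * lam * wint ω t (fun r => ⟪(matL2 T P.Q y - matL2 T P.Q x) r,
          (P.opM u α μ (matL2 T P.Q⁻¹ (matL2 T P.Q y)) -
            P.opM u α μ (matL2 T P.Q⁻¹ (matL2 T P.Q x))) r⟫) := by
  obtain ⟨-, r, hr1, hr2⟩ := hP.lionsMercierStep_spec hlam hμ hα₀ hα₁ y
  set N := (1 - α) • P.R + μ • (P.E * P.Q⁻¹) - P.Jo with hN
  set v := matL2 T P.Q x with hv
  set w := matL2 T P.Q y with hw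
  set w' := matL2 T P.Q (P.lionsMercierStep x₀ u α μ lam y) with hw'
  set b := P.opM u α μ (matL2 T P.Q⁻¹ w) - P.opM u α μ (matL2 T P.Q⁻¹ v) with hb
  set b' := P.opM u α μ (matL2 T P.Q⁻¹ w') - P.opM u α μ (matL2 T P.Q⁻¹ v) with hb'
  have e1 : (w - v) + (-lam) • b = (r - v) + lam • matL2 T N (r - v) := by
    rw [hb, ← shiftM_sub, ← hr1, hP.shiftM_neg_solution hx, hP.shiftN_sub]
  have e2 : (w' - v) + lam • b' = (r - v) + (-lam) • matL2 T N (r - v) := by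
    rw [hb', ← shiftM_sub, hr2, ← hP.shiftN_sub, ← hP.shiftM_neg_solution hx, neg_neg]
  have h1 : ∀ᵐ t ∂timeMeasure T, (w - v) t - lam • b t =
      (r - v) t + lam • matCLM N ((r - v) t) := by
    filter_upwards [coeFn_add_smul (w - v) b (-lam), coeFn_add_smul (r - v) (matL2 T N (r - v)) lam,
      matL2_ae N (r - v)] with t f1 f2 f3
    rw [sub_eq_add_neg, ← neg_smul, ← f1, e1, f2, f3]
  have h2 : ∀ᵐ t ∂timeMeasure T, (w' - v) t + lam • b' t =
      (r - v) t - lam • matCLM N ((r - v) t) := by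
    filter_upwards [coeFn_add_smul (w' - v) b' lam,
      coeFn_add_smul (r - v) (matL2 T N (r - v)) (-lam), matL2_ae N (r - v)] with t f1 f2 f3
    rw [← f1, e2, f2, f3, neg_smul, ← sub_eq_add_neg]
  have hstep := wint_norm_sq_step (Lp.memLp (w - v)) (Lp.memLp b) (Lp.memLp (r - v))
    (hP.inner_N_nonneg hα₁ hμ) hlam.le h1 h2 ω ht
  have c1 : ∀ w c, wint ω t (fun r => ‖(w - v) r + lam • c r‖ ^ 2) =
      wint ω t (fun r => ‖((w - v) + lam • c) r‖ ^ 2) := fun w c => by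
    refine wint_congr ?_ ω ht
    filter_upwards [coeFn_add_smul (w - v) c lam] with t f
    rw [f]
  rwa [c1, c1, hb, hb', ← shiftM_sub, ← shiftM_sub] at hstep

end Assumption

end PHBlocks

/-! ### Convergence of the iteration -/

namespace PHBlocks

open scoped RealInnerProductSpace
open scoped Matrix

variable {s m : ℕ} {nn : Fin s → ℕ} {P : PHBlocks s nn m} {T : ℝ}
  {x₀ : EuclideanSpace ℝ (Idx nn)} {u : L2 T (Fin m)}

namespace Assumption

variable {α μ lam : ℝ}

lemma _root_.wnorm_eq_sqrt_wint (hT : 0 ≤ T) {κ : Type} [Fintype κ] (ω : ℝ) (f : L2 T κ) :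
    wnorm ω f = Real.sqrt (wint ω T fun t => ‖f t‖ ^ 2) := by
  rw [wnorm, wint, integral_Icc_eq_integral_Ioc, ← intervalIntegral.integral_of_le hT]

lemma wint_norm_sq_shiftM_sub (v w : L2 T (Idx nn)) (ω : ℝ) {t : ℝ} (ht : t ∈ Icc 0 T) :
    wint ω t (fun r => ‖(P.shiftM u α μ lam v - P.shiftM u α μ lam w) r‖ ^ 2) =
      wint ω t (fun r => ‖(v - w) r + lam • (P.opM u α μ (matL2 T P.Q⁻¹ v) -
        P.opM u α μ (matL2 T P.Q⁻¹ w)) r‖ ^ 2) := by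
  refine wint_congr ?_ ω ht
  rw [shiftM_sub]
  filter_upwards [coeFn_add_smul (v - w) (P.opM u α μ (matL2 T P.Q⁻¹ v) -
    P.opM u α μ (matL2 T P.Q⁻¹ w)) lam] with r hr
  rw [hr]

lemma wnorm_sub_le (hP : P.Assumption T x₀ u) (hlam : 0 < lam) (hα₀ : 0 ≤ α)
    {x y : L2 T (Idx nn)} (hx : x ∈ P.domM x₀) (hy : y ∈ P.domM x₀) {ω : ℝ} (hω : μ ≤ ω) :
    wnorm ω (y - x) ≤ ‖matCLM P.Q⁻¹‖ *
      wnorm ω (P.shiftM u α μ lam (matL2 T P.Q y) - P.shiftM u α μ lam (matL2 T P.Q x)) := by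
  have hTT : T ∈ Icc 0 T := ⟨hP.T_pos.le, le_rfl⟩
  set a := matL2 T P.Q y - matL2 T P.Q x with ha
  have ha' : y - x = matL2 T P.Q⁻¹ a := by
    rw [ha, map_sub, hP.matL2_Q_inv_Q, hP.matL2_Q_inv_Q]
  rw [wnorm_eq_sqrt_wint hP.T_pos.le, wnorm_eq_sqrt_wint hP.T_pos.le,
    ← Real.sqrt_sq (norm_nonneg (matCLM P.Q⁻¹)), ← Real.sqrt_mul (sq_nonneg _)]
  refine Real.sqrt_le_sqrt ?_
  have h1 : wint ω T (fun t => ‖(y - x) t‖ ^ 2) ≤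
      ‖matCLM P.Q⁻¹‖ ^ 2 * wint ω T fun t => ‖a t‖ ^ 2 := by
    rw [ha', wint_congr (ψ := fun t => ‖matCLM P.Q⁻¹ (a t)‖ ^ 2) ?_ ω hTT, ← wint_const_mul]
    · refine wint_mono (MemLp.integrable_norm_sq (MemLp.clm _ (Lp.memLp a)))
        ((MemLp.integrable_norm_sq (Lp.memLp a)).const_mul _) (fun t => ?_) ω hTT
      rw [← mul_pow]
      gcongr
      exact ContinuousLinearMap.le_opNorm _ _
    · filter_upwards [matL2_ae P.Q⁻¹ a] with t ht
      rw [ht]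
  refine h1.trans (mul_le_mul_of_nonneg_left ?_ (sq_nonneg _))
  rw [wint_norm_sq_shiftM_sub _ _ _ hTT]
  exact wint_norm_sq_le (Lp.memLp a) (Lp.memLp _) hlam.le ω hTT
    (hP.wint_opM_nonneg hα₀ ⟨y, hy, rfl⟩ ⟨x, hx, rfl⟩ hω hTT)

section Iteration

variable {x : L2 T (Idx nn)} {xs : ℕ → L2 T (Idx nn)}

lemma iterate_mem_domM (hP : P.Assumption T x₀ u) (hlam : 0 < lam) (hμ : 0 ≤ μ)
    (hα₀ : 0 ≤ α) (hα₁ : α ≤ 1) (h0 : xs 0 ∈ P.domM x₀)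
    (hxs : ∀ k, xs (k + 1) = P.lionsMercierStep x₀ u α μ lam (xs k)) (k : ℕ) :
    xs k ∈ P.domM x₀ := by
  cases k with
  | zero => exact h0
  | succ k => rw [hxs]; exact (hP.lionsMercierStep_spec hlam hμ hα₀ hα₁ _).1

/-- These integrals bound the decrease of the squared distances from below. Stating this on every
`[0,t]` is what makes pointwise convergence accessible. -/
lemma tendsto_wint_opM (hP : P.Assumption T x₀ u) (hlam : 0 < lam) (hμ : 0 ≤ μ)
    (hα₀ : 0 ≤ α) (hα₁ : α ≤ 1) (hx : P.IsSolution x₀ u x) (h0 : xs 0 ∈ P.domM x₀)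
    (hxs : ∀ k, xs (k + 1) = P.lionsMercierStep x₀ u α μ lam (xs k)) {ω : ℝ} (hω : μ ≤ ω)
    {t : ℝ} (ht : t ∈ Icc 0 T) :
    Tendsto (fun k => wint ω t (fun r => ⟪(matL2 T P.Q (xs k) - matL2 T P.Q x) r,
      (P.opM u α μ (matL2 T P.Q⁻¹ (matL2 T P.Q (xs k))) -
        P.opM u α μ (matL2 T P.Q⁻¹ (matL2 T P.Q x))) r⟫)) atTop (𝓝 0) := by
  have hmem := hP.iterate_mem_domM hlam hμ hα₀ hα₁ h0 hxs
  refine tendsto_zero_of_le_sub (c := 4 * lam) (by positivity)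
    (S := fun k => wint ω t (fun r => ‖(P.shiftM u α μ lam (matL2 T P.Q (xs k)) -
      P.shiftM u α μ lam (matL2 T P.Q x)) r‖ ^ 2))
    (fun k => wint_nonneg (fun _ => sq_nonneg _) ω ht.1)
    (fun k => hP.wint_opM_nonneg hα₀ ⟨_, hmem k, rfl⟩ (solution_mem_domMQ hx) hω ht) fun k => ?_
  rw [hxs]
  exact hP.wint_lionsMercierStep hlam hμ hα₀ hα₁ hx (xs k) ω ht

lemma antitone_wnorm (hP : P.Assumption T x₀ u) (hlam : 0 < lam) (hμ : 0 ≤ μ)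
    (hα₀ : 0 ≤ α) (hα₁ : α ≤ 1) (hx : P.IsSolution x₀ u x) (h0 : xs 0 ∈ P.domM x₀)
    (hxs : ∀ k, xs (k + 1) = P.lionsMercierStep x₀ u α μ lam (xs k)) {ω : ℝ} (hω : μ ≤ ω) :
    Antitone (fun k => wnorm ω
      (P.shiftM u α μ lam (matL2 T P.Q (xs k)) - P.shiftM u α μ lam (matL2 T P.Q x))) := by
  have hmem := hP.iterate_mem_domM hlam hμ hα₀ hα₁ h0 hxs
  have hTT : T ∈ Icc 0 T := ⟨hP.T_pos.le, le_rfl⟩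
  refine antitone_nat_of_succ_le fun k => ?_
  rw [wnorm_eq_sqrt_wint hP.T_pos.le, wnorm_eq_sqrt_wint hP.T_pos.le, hxs]
  refine Real.sqrt_le_sqrt ((hP.wint_lionsMercierStep hlam hμ hα₀ hα₁ hx (xs k) ω hTT).trans ?_)
  have := hP.wint_opM_nonneg (u := u) hα₀ ⟨_, hmem k, rfl⟩ (solution_mem_domMQ hx) hω hTT
  have := mul_nonneg (mul_nonneg zero_le_four hlam.le) this
  linarith

lemma tendsto_E (hP : P.Assumption T x₀ u) (hlam : 0 < lam) (hμ : 0 ≤ μ)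
    (hα₀ : 0 ≤ α) (hα₁ : α ≤ 1) (hx : P.IsSolution x₀ u x) (h0 : xs 0 ∈ P.domM x₀)
    (hxs : ∀ k, xs (k + 1) = P.lionsMercierStep x₀ u α μ lam (xs k)) :
    Tendsto (fun k => matL2 T P.E (xs k)) atTop (𝓝 (matL2 T P.E x)) := by
  have hmem := hP.iterate_mem_domM hlam hμ hα₀ hα₁ h0 hxs
  have hTT : T ∈ Icc 0 T := ⟨hP.T_pos.le, le_rfl⟩
  -- With `ω = μ + 1` the integral of `⟨S a, a⟩` has coefficient one.
  have hI := hP.tendsto_wint_opM hlam hμ hα₀ hα₁ hx h0 hxs (ω := μ + 1) (by linarith) hTT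
  rw [tendsto_iff_norm_sub_tendsto_zero, ← tendsto_zero_iff_norm_tendsto_zero]
  set a := fun k => matL2 T P.Q (xs k) - matL2 T P.Q x with ha
  refine tendsto_zero_of_norm_sq_le hP.T_pos.le (c := ‖matCLM (P.E * P.Q⁻¹)‖ + 1) (ω := μ + 1)
    (φ := fun k r => ⟪matCLM (P.E * P.Q⁻¹) (a k r), a k r⟫) (by linarith) (by positivity)
    (fun k => integrable_inner_matCLM _ _) (fun k r => hP.energy_nonneg _) (fun k => ?_) ?_
  · have e : matL2 T P.E (xs k) - matL2 T P.E x = matL2 T (P.E * P.Q⁻¹) (a k) := by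
      rw [← map_sub, matL2_mul]
      simp only [ha, map_sub, hP.matL2_Q_inv_Q]
    rw [e]
    filter_upwards [matL2_ae (P.E * P.Q⁻¹) (a k)] with r hr
    rw [hr]
    exact norm_sq_le_of_symm_of_nonneg hP.energy_symm hP.energy_nonneg _
  · refine squeeze_zero (fun k => wint_nonneg (fun r => hP.energy_nonneg _) _ hP.T_pos.le)
      (fun k => ?_) hI
    obtain ⟨q, hq0, -, hq⟩ := hP.exists_energy_opM (u := u) α μ
      ⟨_, hmem k, rfl⟩ (solution_mem_domMQ hx)
    rw [hq _ T hTT]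
    have h1 := mul_nonneg (Real.exp_pos (-2 * T * (μ + 1))).le (hq0 T hTT)
    have h2 := mul_nonneg hα₀ (wint_nonneg (fun r => hP.R_nonneg (a k r)) (μ + 1) hP.T_pos.le)
    simp only [ha] at h2 ⊢
    linarith

lemma tendsto_RQ (hP : P.Assumption T x₀ u) (hlam : 0 < lam) (hμ : 0 ≤ μ)
    (hα₀ : 0 < α) (hα₁ : α ≤ 1) (hx : P.IsSolution x₀ u x) (h0 : xs 0 ∈ P.domM x₀)
    (hxs : ∀ k, xs (k + 1) = P.lionsMercierStep x₀ u α μ lam (xs k)) :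
    Tendsto (fun k => matL2 T (P.R * P.Q) (xs k)) atTop (𝓝 (matL2 T (P.R * P.Q) x)) := by
  have hmem := hP.iterate_mem_domM hlam hμ hα₀.le hα₁ h0 hxs
  have hTT : T ∈ Icc 0 T := ⟨hP.T_pos.le, le_rfl⟩
  have hI := hP.tendsto_wint_opM hlam hμ hα₀.le hα₁ hx h0 hxs (ω := μ) le_rfl hTT
  have hI' := hI.const_mul α⁻¹
  rw [mul_zero] at hI'
  rw [tendsto_iff_norm_sub_tendsto_zero, ← tendsto_zero_iff_norm_tendsto_zero]
  set a := fun k => matL2 T P.Q (xs k) - matL2 T P.Q x with ha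
  refine tendsto_zero_of_norm_sq_le hP.T_pos.le (c := ‖matCLM P.R‖ + 1) (ω := μ)
    (φ := fun k r => ⟪matCLM P.R (a k r), a k r⟫) hμ (by positivity)
    (fun k => integrable_inner_matCLM _ _) (fun k r => hP.R_nonneg _) (fun k => ?_) ?_
  · have e : matL2 T (P.R * P.Q) (xs k) - matL2 T (P.R * P.Q) x = matL2 T P.R (a k) := by
      rw [← map_sub, matL2_mul, ha, map_sub]
    rw [e]
    filter_upwards [matL2_ae P.R (a k)] with r hr
    rw [hr]
    exact norm_sq_le_of_symm_of_nonneg hP.R_symm hP.R_nonneg _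
  · refine squeeze_zero (fun k => wint_nonneg (fun r => hP.R_nonneg _) _ hP.T_pos.le)
      (fun k => ?_) hI'
    obtain ⟨q, hq0, -, hq⟩ := hP.exists_energy_opM (u := u) α μ
      ⟨_, hmem k, rfl⟩ (solution_mem_domMQ hx)
    rw [hq _ T hTT, le_inv_mul_iff₀ hα₀]
    have h1 := mul_nonneg (Real.exp_pos (-2 * T * μ)).le (hq0 T hTT)
    simp only [ha]
    linarith

lemma tendsto_contRep (hP : P.Assumption T x₀ u) (hlam : 0 < lam) (hμ : 0 ≤ μ)
    (hα₀ : 0 ≤ α) (hα₁ : α ≤ 1) (hx : P.IsSolution x₀ u x) (h0 : xs 0 ∈ P.domM x₀)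
    (hxs : ∀ k, xs (k + 1) = P.lionsMercierStep x₀ u α μ lam (xs k)) :
    ∃ (Y : ℝ → EuclideanSpace ℝ (Idx nn)) (Ys : ℕ → ℝ → EuclideanSpace ℝ (Idx nn)),
      IsContRep (matL2 T P.E x) Y ∧ (∀ k, IsContRep (matL2 T P.E (xs k)) (Ys k)) ∧
        ∀ t ∈ Set.Ioc 0 T, Tendsto (fun k => Ys k t) atTop (𝓝 (Y t)) := by
  have hmem := hP.iterate_mem_domM hlam hμ hα₀ hα₁ h0 hxs
  have hE : ∀ y : L2 T (Idx nn), matL2 T (P.E * P.Q⁻¹) (matL2 T P.Q y) = matL2 T P.E y :=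
    fun y => by rw [← matL2_mul, hP.E_mul_inv_mul]
  have hrep : ∀ y ∈ P.domM x₀, IsContRep (matL2 T P.E y) (fun t => matCLM P.E x₀ +
      ∫ r in (0 : ℝ)..t, weakDeriv (matL2 T P.E y) r) := fun y hy =>
    (isPrim_of_mem_domM hP.T_pos hy).isContRep hP.T_pos
  refine ⟨_, _, hrep x hx.1, fun k => hrep _ (hmem k), fun t ht => ?_⟩
  have ht' : t ∈ Icc 0 T := ⟨ht.1.le, ht.2⟩
  refine Tendsto.const_add _ ?_
  -- The initial values agree, so the difference of the primitives is controlled by `q k t`. With `ω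
  -- = μ` only the end-point energy and the `R` term remain.
  have hI := hP.tendsto_wint_opM hlam hμ hα₀ hα₁ hx h0 hxs (ω := μ) le_rfl ht'
  have hI' := hI.const_mul (2 * (Real.exp (-2 * t * μ))⁻¹)
  rw [mul_zero] at hI'
  choose q hq0 hq1 hq2 using fun k => hP.exists_energy_opM (u := u) α μ
    (⟨_, hmem k, rfl⟩ : matL2 T P.Q (xs k) ∈ P.domMQ x₀) (solution_mem_domMQ hx)
  have hqlim : Tendsto (fun k => q k t) atTop (𝓝 0) := by
    refine squeeze_zero (fun k => hq0 k t ht') (fun k => ?_)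
      hI'
    rw [hq2 k μ t ht', sub_self, zero_mul, zero_add]
    have h2 := mul_nonneg hα₀ (wint_nonneg (fun r => hP.R_nonneg
      ((matL2 T P.Q (xs k) - matL2 T P.Q x) r)) μ ht.1.le)
    have he := Real.exp_pos (-2 * t * μ)
    calc q k t = 2 * (Real.exp (-2 * t * μ))⁻¹ * (1 / 2 * (Real.exp (-2 * t * μ) * q k t)) := by
          field_simp
      _ ≤ _ := by gcongr; linarith
  rw [tendsto_iff_norm_sub_tendsto_zero]
  have hsq : Tendsto (fun k => ‖(∫ r in (0 : ℝ)..t, weakDeriv (matL2 T P.E (xs k)) r) -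
      ∫ r in (0 : ℝ)..t, weakDeriv (matL2 T P.E x) r‖ ^ 2) atTop (𝓝 0) := by
    refine squeeze_zero (fun k => sq_nonneg _) (fun k => ?_)
      (by simpa using hqlim.const_mul (‖matCLM (P.E * P.Q⁻¹)‖ + 1))
    simpa only [hE] using hq1 k t ht'
  simpa using hsq.sqrt

end Iteration

end Assumption

end PHBlocks

theorem theorem1 {s m : ℕ} {nn : Fin s → ℕ} (P : PHBlocks s nn m) (T : ℝ)
    (x₀ : EuclideanSpace ℝ (Idx nn)) (u : L2 T (Fin m)) (hP : P.Assumption T x₀ u)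
    (lam μ α : ℝ) (hlam : 0 < lam) (hμ : 0 ≤ μ) (hα₀ : 0 ≤ α) (hα₁ : α ≤ 1) :
    -- the objects of the theorem are well defined
    (∃! x : L2 T (Idx nn), P.IsSolution x₀ u x) ∧
    Function.Bijective (P.shiftN (T := T) α μ lam) ∧
    Set.BijOn (P.shiftM u α μ lam) (P.domMQ x₀) Set.univ ∧
    ∀ x : L2 T (Idx nn), P.IsSolution x₀ u x →
    ∀ xs : ℕ → L2 T (Idx nn), xs 0 ∈ P.domM x₀ →
      (∀ k, xs (k + 1) = P.lionsMercierStep x₀ u α μ lam (xs k)) →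
      (∀ k, xs k ∈ P.domM x₀) ∧
      -- (a)
      Tendsto (fun k => matL2 T P.E (xs k)) atTop (𝓝 (matL2 T P.E x)) ∧
      -- (b)
      (∃ (Y : ℝ → EuclideanSpace ℝ (Idx nn)) (Ys : ℕ → ℝ → EuclideanSpace ℝ (Idx nn)),
        IsContRep (matL2 T P.E x) Y ∧ (∀ k, IsContRep (matL2 T P.E (xs k)) (Ys k)) ∧
        ∀ t ∈ Set.Ioc 0 T, Tendsto (fun k => Ys k t) atTop (𝓝 (Y t))) ∧
      -- (c)
      (0 < α →
        Tendsto (fun k => matL2 T (P.R * P.Q) (xs k)) atTop (𝓝 (matL2 T (P.R * P.Q) x))) ∧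
      -- (d)
      ∀ ω : ℝ, μ ≤ ω →
        Antitone (fun k => wnorm ω
          (P.shiftM u α μ lam (matL2 T P.Q (xs k)) - P.shiftM u α μ lam (matL2 T P.Q x))) ∧
        ∀ k, wnorm ω (xs k - x) ≤ ‖matCLM P.Q⁻¹‖ *
          wnorm ω
            (P.shiftM u α μ lam (matL2 T P.Q (xs k)) - P.shiftM u α μ lam (matL2 T P.Q x)) := by
  refine ⟨?_, hP.bijective_shiftN hlam hμ hα₁, hP.bijOn_shiftM hlam hμ hα₀,
    fun x hx xs h0 hxs => ?_⟩
  · obtain ⟨x, hx⟩ := hP.exists_solution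
    exact ⟨x, hx, fun y hy => hP.solution_unique hy hx⟩
  · have hmem := hP.iterate_mem_domM hlam hμ hα₀ hα₁ h0 hxs
    exact ⟨hmem, hP.tendsto_E hlam hμ hα₀ hα₁ hx h0 hxs,
      hP.tendsto_contRep hlam hμ hα₀ hα₁ hx h0 hxs,
      fun hα => hP.tendsto_RQ hlam hμ hα hα₁ hx h0 hxs,
      fun ω hω => ⟨hP.antitone_wnorm hlam hμ hα₀ hα₁ hx h0 hxs hω,
        fun k => hP.wnorm_sub_le hlam hα₀ hx.1 (hmem k) hω⟩⟩
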